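/- For $n\ge 0$ the key polynomials $\{\mathcal K_\alpha\}_{\alpha\in\mathbb Z_{\ge 0}^n}\subset\mathbb Z[x_1,\dots,x_n]$ are the unique family such that $\mathcal K_\alpha=x^\alpha$ if $\alpha_1\ge\cdots\ge\alpha_n$, and $\mathcal K_{s_i(\alpha)}=\xi_i(\mathcal K_\alpha)$ whenever $\alpha_i>\alpha_{i+1}$, where $s_i$ interchanges the entries (respectively the variables) $i$ and $i+1$ and $\xi_i(f)=\frac{x_i f-x_{i+1}s_i(f)}{x_i-x_{i+1}}$. Let $\mathrm{Par}$ be the set of all partitions, and let $\ell(\lambda)$ be the number of (nonzero) parts of $\lambda \in \mathrm{Par}$. Let $r\ge 0$, and let $X_i=\{x_{i,1},x_{i,2},\dots\}$, $1\le i\le r$, be infinite sets of variables. For $\underline\lambda=(\lambda^{(1)}|\cdots|\lambda^{(r)})\in\mathrm{Par}^r$ and $n_i\ge\ell(\lambda^{(i)})$ put $$\mathcal S_{\underline\lambda}^{(n_1|\cdots|n_r)}=\mathcal K_{(0^{n_1-\ell(\lambda^{(1)})}*\mathrm{rev}(\lambda^{(1)}))*\cdots*(0^{n_r-\ell(\lambda^{(r)})}*\mathrm{rev}(\lambda^{(r)}))}(x_{1,1},\dots,x_{1,n_1},\dots,x_{r,1},\dots,x_{r,n_r}),$$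 where $*$ is concatenation and $\mathrm{rev}(\lambda)$ lists the parts of $\lambda$ in weakly increasing order. The multi-symmetric Schur function $\mathcal S_{\underline\lambda}$ is the limit of $\mathcal S_{\underline\lambda}^{(n_1|\cdots|n_r)}$ as $n_1,\dots,n_r\to\infty$, taken coefficientwise (each coefficient being eventually constant) in the ring of formal power series over $\mathbb Z$ in the variables $x_{i,j}$. Let $\Lambda_{\mathbb Z}(X)$ be the ring of symmetric functions (symmetric formal power series of bounded degree) over $\mathbb Z$ in the variables $X$, and let $\Lambda_{\mathbb Z}(X_1|\cdots|X_r)=\Lambda_{\mathbb Z}(X_1)\otimes_{\mathbb Z}\cdots\otimes_{\mathbb Z}\Lambda_{\mathbb Z}(X_r)$. Then all these limits exist; the map $f_1\otimes\cdots\otimes f_r\mapsto f_1(X_1)\cdots f_r(X_r)$ from $\Lambda_{\mathbb Z}(X_1|\cdots|X_r)$ to the ring of formal power series in the $x_{i,j}$ is injective; and, when $\Lambda_{\mathbb Z}(X_1|\cdots|X_r)$ is identified with its image under this map, the multi-symmetric Schur functions $\mathcal S_{\underline\lambda}$, $\underline\lambda\in\mathrm{Par}^r$, belong to $\Lambda_{\mathbb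 Z}(X_1|\cdots|X_r)$ and form a $\mathbb Z$-basis of it. -/

import Mathlib

open Filter Topology
open scoped TensorProduct MvPowerSeries.WithPiTopology

namespace MultiSchur

noncomputable section

/-! ### Isobaric divided difference operators -/

section Operators

variable {σ R : Type*} [DecidableEq σ] [CommRing R]

/-- `s_{x,y} f`: the polynomial `f` with the variables `x` and `y` interchanged. -/
def swapVar (x y : σ) : MvPolynomial σ R →ₐ[R] MvPolynomial σ R :=
  MvPolynomial.rename (Equiv.swap x y)

theorem X_sub_X_dvd_sub_swapVar (x y : σ) (f : MvPolynomial σ R) :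
    (MvPolynomial.X x - MvPolynomial.X y) ∣ f - swapVar x y f := by
  induction f using MvPolynomial.induction_on with
  | C a => simp [swapVar]
  | add p q hp hq =>
    rw [map_add, add_sub_add_comm]
    exact dvd_add hp hq
  | mul_X p z hp =>
    have hz : (MvPolynomial.X x - MvPolynomial.X y : MvPolynomial σ R) ∣
        MvPolynomial.X z - swapVar x y (MvPolynomial.X z) := by
      simp only [swapVar, MvPolynomial.rename_X]
      by_cases hx : z = x
      · subst hx; simp
      · by_cases hy : z = y
        · subst hy
          rw [Equiv.swap_apply_right]
          exact ⟨-1, by ring⟩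
        · simp [Equiv.swap_apply_of_ne_of_ne hx hy]
    have : p * MvPolynomial.X z - swapVar x y (p * MvPolynomial.X z) =
        (p - swapVar x y p) * MvPolynomial.X z +
          swapVar x y p * (MvPolynomial.X z - swapVar x y (MvPolynomial.X z)) := by
      rw [map_mul]; ring
    rw [this]
    exact dvd_add (hp.mul_right _) (hz.mul_left _)

theorem X_sub_X_dvd (x y : σ) (f : MvPolynomial σ R) :
    (MvPolynomial.X x - MvPolynomial.X y) ∣
      MvPolynomial.X x * f - MvPolynomial.X y * swapVar x y f := by
  have : MvPolynomial.X x * f - MvPolynomial.X y * swapVar x y f =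
      (MvPolynomial.X x - MvPolynomial.X y) * f +
        MvPolynomial.X y * (f - swapVar x y f) := by ring
  rw [this]
  exact dvd_add (dvd_mul_right _ _) ((X_sub_X_dvd_sub_swapVar x y f).mul_left _)

/-- The isobaric divided difference `ξ_{x,y} f = (x f - y s_{x,y} f) / (x - y)`. -/
def isobaric (x y : σ) (f : MvPolynomial σ R) : MvPolynomial σ R :=
  (X_sub_X_dvd x y f).choose

theorem isobaric_spec (x y : σ) (f : MvPolynomial σ R) :
    (MvPolynomial.X x - MvPolynomial.X y) * isobaric x y f =
      MvPolynomial.X x * f - MvPolynomial.X y * swapVar x y f :=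
  (X_sub_X_dvd x y f).choose_spec.symm

end Operators

/-! ### Key polynomials -/

/-- The defining properties of the family of key polynomials in `n` variables (indexed by
`Fin n`): `K_α = x^α` for weakly decreasing `α`, and `K_{s_i α} = ξ_i K_α` if `α_i > α_{i+1}`. -/
structure IsKeyFamily (R : Type*) [CommRing R] (n : ℕ)
    (K : (Fin n → ℕ) → MvPolynomial (Fin n) R) : Prop where
  of_antitone : ∀ α : Fin n → ℕ, Antitone α → K α = ∏ i, MvPolynomial.X i ^ α i
  of_descent : ∀ (α : Fin n → ℕ) (i j : Fin n), (i : ℕ) + 1 = j → α j < α i →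
    K (α ∘ Equiv.swap i j) = isobaric i j (K α)

/-- A pair of adjacent positions at which `α` increases. -/
def IsAscent {n : ℕ} (α : Fin n → ℕ) (p : Fin n × Fin n) : Prop :=
  (p.1 : ℕ) + 1 = p.2 ∧ α p.1 < α p.2

theorem weight_swap_lt {n : ℕ} {α : Fin n → ℕ} {p : Fin n × Fin n} (h : IsAscent α p) :
    ∑ k : Fin n, (k : ℕ) * (α ∘ Equiv.swap p.1 p.2) k < ∑ k : Fin n, (k : ℕ) * α k := by
  obtain ⟨i, j⟩ := p
  obtain ⟨hij, hlt⟩ := h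
  simp only at hij hlt
  have hne : j ≠ i := by
    intro h
    rw [h] at hij
    omega
  rw [← Finset.add_sum_erase _ _ (Finset.mem_univ i),
    ← Finset.add_sum_erase (Finset.univ.erase i) _ (Finset.mem_erase.2 ⟨hne, Finset.mem_univ j⟩),
    ← Finset.add_sum_erase _ (fun k : Fin n => (k : ℕ) * α k) (Finset.mem_univ i),
    ← Finset.add_sum_erase (Finset.univ.erase i) (fun k : Fin n => (k : ℕ) * α k)
      (Finset.mem_erase.2 ⟨hne, Finset.mem_univ j⟩)]
  have hrest : ∑ k ∈ (Finset.univ.erase i).erase j, (k : ℕ) * (α ∘ Equiv.swap i j) k =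
      ∑ k ∈ (Finset.univ.erase i).erase j, (k : ℕ) * α k := by
    refine Finset.sum_congr rfl fun k hk => ?_
    simp only [Finset.mem_erase] at hk
    simp [Equiv.swap_apply_of_ne_of_ne hk.2.1 hk.1]
  rw [hrest]
  simp only [Function.comp_apply, Equiv.swap_apply_left, Equiv.swap_apply_right]
  rw [← hij]
  nlinarith

open Classical in
/-- The key polynomial `K_α ∈ R[x_1, …, x_n]`, computed by sorting `α` into weakly decreasing
order. By `isKeyFamily_keyPoly` and `IsKeyFamily.eq_keyPoly` these polynomials are the unique
family with the defining properties of the key polynomials. -/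
def keyPoly (R : Type*) [CommRing R] (n : ℕ) (α : Fin n → ℕ) : MvPolynomial (Fin n) R :=
  if h : ∃ p, IsAscent α p then
    isobaric h.choose.1 h.choose.2 (keyPoly R n (α ∘ Equiv.swap h.choose.1 h.choose.2))
  else ∏ i, MvPolynomial.X i ^ α i
termination_by ∑ k : Fin n, (k : ℕ) * α k
decreasing_by exact weight_swap_lt h.choose_spec

section KeyFamily

variable {R : Type*} [CommRing R]

theorem antitone_of_not_isAscent {n : ℕ} {α : Fin n → ℕ} (h : ¬ ∃ p, IsAscent α p) :
    Antitone α := by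
  cases n with
  | zero => exact fun i => i.elim0
  | succ m =>
    rw [Fin.antitone_iff_succ_le]
    intro i
    by_contra hlt
    exact h ⟨(i.castSucc, i.succ), by simp, not_le.1 hlt⟩

theorem not_isAscent_of_antitone {n : ℕ} {α : Fin n → ℕ} (h : Antitone α) :
    ¬ ∃ p, IsAscent α p := by
  rintro ⟨p, hp, hlt⟩
  exact absurd (h (show p.1 ≤ p.2 from Fin.le_def.2 (by omega))) (not_le.2 hlt)

variable {σ : Type*} [DecidableEq σ]

@[simp]
theorem swapVar_X_left (x y : σ) :
    swapVar x y (MvPolynomial.X x : MvPolynomial σ R) = MvPolynomial.X y := by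
  simp [swapVar]

@[simp]
theorem swapVar_X_right (x y : σ) :
    swapVar x y (MvPolynomial.X y : MvPolynomial σ R) = MvPolynomial.X x := by
  simp [swapVar]

theorem swapVar_X_of_ne {x y z : σ} (hx : z ≠ x) (hy : z ≠ y) :
    swapVar x y (MvPolynomial.X z : MvPolynomial σ R) = MvPolynomial.X z := by
  simp [swapVar, Equiv.swap_apply_of_ne_of_ne hx hy]

@[simp]
theorem swapVar_swapVar (x y : σ) (f : MvPolynomial σ R) :
    swapVar x y (swapVar x y f) = f := by
  have : (Equiv.swap x y : σ → σ) ∘ Equiv.swap x y = id := by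
    funext z; simp
  simp [swapVar, MvPolynomial.rename_rename, this]

variable [IsDomain R]

theorem X_sub_X_ne_zero {τ : Type*} {x y : τ} (h : x ≠ y) :
    (MvPolynomial.X x - MvPolynomial.X y : MvPolynomial τ R) ≠ 0 :=
  sub_ne_zero.2 fun hxy => h (MvPolynomial.X_injective hxy)

theorem swapVar_isobaric {x y : σ} (h : x ≠ y) (f : MvPolynomial σ R) :
    swapVar x y (isobaric x y f) = isobaric x y f := by
  have h1 := isobaric_spec x y f
  have h2 := congrArg (swapVar x y) h1
  simp only [map_mul, map_sub, swapVar_X_left, swapVar_X_right, swapVar_swapVar] at h2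
  refine mul_left_cancel₀ (X_sub_X_ne_zero (R := R) h) ?_
  linear_combination -h1 - h2

theorem isobaric_comm {a b c d : σ} (hab : a ≠ b) (hcd : c ≠ d) (hac : a ≠ c) (had : a ≠ d)
    (hbc : b ≠ c) (hbd : b ≠ d) (f : MvPolynomial σ R) :
    isobaric a b (isobaric c d f) = isobaric c d (isobaric a b f) := by
  have hs : swapVar a b (swapVar c d f) = swapVar c d (swapVar a b f) := by
    have : (Equiv.swap a b : σ → σ) ∘ Equiv.swap c d = Equiv.swap c d ∘ Equiv.swap a b := by
      funext z
      simp only [Function.comp_apply, Equiv.swap_apply_def]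
      grind
    simp [swapVar, MvPolynomial.rename_rename, this]
  have e1 := isobaric_spec a b (isobaric c d f)
  have e2 := isobaric_spec c d f
  have e3 := congrArg (swapVar a b) e2
  have f1 := isobaric_spec c d (isobaric a b f)
  have f2 := isobaric_spec a b f
  have f3 := congrArg (swapVar c d) f2
  simp only [map_mul, map_sub, swapVar_X_of_ne hac.symm hbc.symm,
    swapVar_X_of_ne had.symm hbd.symm] at e3
  simp only [map_mul, map_sub, swapVar_X_of_ne hac had, swapVar_X_of_ne hbc hbd] at f3
  refine mul_left_cancel₀ (mul_ne_zero (X_sub_X_ne_zero (R := R) hab)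
    (X_sub_X_ne_zero (R := R) hcd)) ?_
  linear_combination (MvPolynomial.X c - MvPolynomial.X d) * e1 + MvPolynomial.X a * e2 -
    MvPolynomial.X b * e3 - (MvPolynomial.X a - MvPolynomial.X b) * f1 - MvPolynomial.X c * f2 +
    MvPolynomial.X d * f3 + MvPolynomial.X b * MvPolynomial.X d * hs

theorem isobaric_braid {a b c : σ} (hab : a ≠ b) (hbc : b ≠ c) (hac : a ≠ c)
    (f : MvPolynomial σ R) :
    isobaric a b (isobaric b c (isobaric a b f)) =
      isobaric b c (isobaric a b (isobaric b c f)) := by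
  have hs : swapVar a b (swapVar b c (swapVar a b f)) =
      swapVar b c (swapVar a b (swapVar b c f)) := by
    have : ((Equiv.swap a b : σ → σ) ∘ Equiv.swap b c) ∘ Equiv.swap a b =
        (Equiv.swap b c ∘ Equiv.swap a b) ∘ Equiv.swap b c := by
      funext z
      simp only [Function.comp_apply, Equiv.swap_apply_def]
      grind
    simp only [swapVar, MvPolynomial.rename_rename]
    rw [← Function.comp_assoc, ← Function.comp_assoc, this]
  have e1 := isobaric_spec a b (isobaric b c (isobaric a b f))
  have e2 := isobaric_spec b c (isobaric a b f)
  have e3 := congrArg (swapVar a b) e2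
  have e4 := isobaric_spec a b f
  have e5 := congrArg (swapVar b c) e4
  have e6 := congrArg (swapVar a b) e5
  have f1 := isobaric_spec b c (isobaric a b (isobaric b c f))
  have f2 := isobaric_spec a b (isobaric b c f)
  have f3 := congrArg (swapVar b c) f2
  have f4 := isobaric_spec b c f
  have f5 := congrArg (swapVar a b) f4
  have f6 := congrArg (swapVar b c) f5
  simp only [map_mul, map_sub, swapVar_X_left, swapVar_X_right,
    swapVar_X_of_ne hab hac, swapVar_X_of_ne hac.symm hbc.symm,
    swapVar_isobaric hab, swapVar_isobaric hbc] at e3 e5 e6 f3 f5 f6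
  refine mul_left_cancel₀ (mul_ne_zero (mul_ne_zero (X_sub_X_ne_zero (R := R) hab)
    (X_sub_X_ne_zero (R := R) hbc)) (X_sub_X_ne_zero (R := R) hac)) ?_
  set A : MvPolynomial σ R := MvPolynomial.X a
  set B : MvPolynomial σ R := MvPolynomial.X b
  set C : MvPolynomial σ R := MvPolynomial.X c
  linear_combination (B - C) * (A - C) * e1 + A * (A - C) * e2 - B * (B - C) * e3 + A * B * e4
    - A * C * e5 + B * C * e6
    - ((A - B) * (A - C) * f1 + B * (A - C) * f2 - C * (A - B) * f3 + A ^ 2 * f4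
    - B ^ 2 * f5 + C ^ 2 * f6) - B * C ^ 2 * hs

theorem comp_swap_swap {n : ℕ} (α : Fin n → ℕ) (i j : Fin n) :
    (α ∘ Equiv.swap i j) ∘ Equiv.swap i j = α := by
  funext k; simp

theorem keyPoly_of_ascent {n : ℕ} (α : Fin n → ℕ) (p : Fin n × Fin n) (hp : IsAscent α p) :
    keyPoly R n α = isobaric p.1 p.2 (keyPoly R n (α ∘ Equiv.swap p.1 p.2)) := by
  obtain ⟨N, hN⟩ : ∃ N, N = ∑ k : Fin n, (k : ℕ) * α k := ⟨_, rfl⟩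
  induction N using Nat.strong_induction_on generalizing α p with
  | _ N ih =>
    subst hN
    -- two consecutive ascents
    have braid : ∀ a b c : Fin n, IsAscent α (a, b) → IsAscent α (b, c) →
        isobaric a b (keyPoly R n (α ∘ Equiv.swap a b)) =
          isobaric b c (keyPoly R n (α ∘ Equiv.swap b c)) := by
      intro a b c h1 h2
      have hab : a ≠ b := fun h => by have := h1.1; simp [h] at this
      have hbc : b ≠ c := fun h => by have := h2.1; simp [h] at this
      have hac : a ≠ c := fun h => by have h1 := h1.1; have h2 := h2.1; simp [h] at h1 h2; omega
      obtain ⟨h1a, h1b⟩ := h1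
      obtain ⟨h2a, h2b⟩ := h2
      simp only at h1a h1b h2a h2b
      have w1 := weight_swap_lt (α := α) (p := (a, b)) ⟨h1a, h1b⟩
      have w2 := weight_swap_lt (α := α) (p := (b, c)) ⟨h2a, h2b⟩
      have x1 : IsAscent (α ∘ Equiv.swap a b) (b, c) := by
        refine ⟨h2a, ?_⟩
        simp only [Function.comp_apply, Equiv.swap_apply_right,
          Equiv.swap_apply_of_ne_of_ne hac.symm hbc.symm]
        omega
      have x2 : IsAscent (α ∘ Equiv.swap b c) (a, b) := by
        refine ⟨h1a, ?_⟩
        simp only [Function.comp_apply, Equiv.swap_apply_left,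
          Equiv.swap_apply_of_ne_of_ne hab hac]
        omega
      have y1 : IsAscent ((α ∘ Equiv.swap a b) ∘ Equiv.swap b c) (a, b) := by
        refine ⟨h1a, ?_⟩
        simp only [Function.comp_apply, Equiv.swap_apply_left,
          Equiv.swap_apply_of_ne_of_ne hab hac,
          Equiv.swap_apply_of_ne_of_ne hac.symm hbc.symm]
        omega
      have y2 : IsAscent ((α ∘ Equiv.swap b c) ∘ Equiv.swap a b) (b, c) := by
        refine ⟨h2a, ?_⟩
        simp only [Function.comp_apply, Equiv.swap_apply_right,
          Equiv.swap_apply_of_ne_of_ne hab hac,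
          Equiv.swap_apply_of_ne_of_ne hac.symm hbc.symm]
        omega
      have v1 := weight_swap_lt x1
      have v2 := weight_swap_lt x2
      have hcomp : ((α ∘ Equiv.swap a b) ∘ Equiv.swap b c) ∘ Equiv.swap a b =
          ((α ∘ Equiv.swap b c) ∘ Equiv.swap a b) ∘ Equiv.swap b c := by
        funext z
        simp only [Function.comp_apply, Equiv.swap_apply_def]
        grind
      rw [ih _ w1 _ _ x1 rfl, ih _ (v1.trans w1) _ _ y1 rfl, ih _ w2 _ _ x2 rfl,
        ih _ (v2.trans w2) _ _ y2 rfl]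
      simp only
      rw [hcomp, isobaric_braid hab hbc hac]
    have hex : ∃ p, IsAscent α p := ⟨p, hp⟩
    have key : keyPoly R n α = isobaric hex.choose.1 hex.choose.2
        (keyPoly R n (α ∘ Equiv.swap hex.choose.1 hex.choose.2)) := by
      conv_lhs => rw [keyPoly]
      rw [dif_pos hex]
    rw [key]
    have hq := hex.choose_spec
    generalize hex.choose = q at hq
    obtain ⟨a, b⟩ := p
    obtain ⟨c, d⟩ := q
    by_cases hac : a = c
    · subst hac
      have : b = d := Fin.ext (by have := hp.1; have := hq.1; simp only at *; omega)
      rw [this]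
    by_cases hbc : b = c
    · subst hbc
      exact (braid _ _ _ hp hq).symm
    by_cases had : a = d
    · subst had
      exact braid _ _ _ hq hp
    have hbd : b ≠ d := fun h => hac (Fin.ext (by
      have h1 := hp.1; have h2 := hq.1; rw [h] at h1; simp only at h1 h2; omega))
    have hab : a ≠ b := fun h => by have := hp.1; simp [h] at this
    have hcd : c ≠ d := fun h => by have := hq.1; simp [h] at this
    have x1 : IsAscent (α ∘ Equiv.swap a b) (c, d) := by
      refine ⟨hq.1, ?_⟩
      simp only [Function.comp_apply, Equiv.swap_apply_of_ne_of_ne (Ne.symm hac) (Ne.symm hbc),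
        Equiv.swap_apply_of_ne_of_ne (Ne.symm had) (Ne.symm hbd)]
      exact hq.2
    have x2 : IsAscent (α ∘ Equiv.swap c d) (a, b) := by
      refine ⟨hp.1, ?_⟩
      simp only [Function.comp_apply, Equiv.swap_apply_of_ne_of_ne hac had,
        Equiv.swap_apply_of_ne_of_ne hbc hbd]
      exact hp.2
    have hcomp : (α ∘ Equiv.swap a b) ∘ Equiv.swap c d =
        (α ∘ Equiv.swap c d) ∘ Equiv.swap a b := by
      funext z
      simp only [Function.comp_apply, Equiv.swap_apply_def]
      grind
    simp only
    rw [ih _ (weight_swap_lt hq) _ _ x2 rfl, ih _ (weight_swap_lt hp) _ _ x1 rfl]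
    simp only
    rw [hcomp, isobaric_comm hab hcd hac had hbc hbd]

theorem isKeyFamily_keyPoly (n : ℕ) : IsKeyFamily R n (keyPoly R n) where
  of_antitone α hα := by
    rw [keyPoly, dif_neg (not_isAscent_of_antitone hα)]
  of_descent α i j hij hlt := by
    have h : IsAscent (α ∘ Equiv.swap i j) (i, j) := ⟨hij, by simpa using hlt⟩
    rw [keyPoly_of_ascent _ _ h]
    simp only
    rw [comp_swap_swap]

theorem IsKeyFamily.eq_keyPoly {n : ℕ} {K : (Fin n → ℕ) → MvPolynomial (Fin n) R}
    (hK : IsKeyFamily R n K) : K = keyPoly R n := by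
  funext α
  obtain ⟨N, hN⟩ : ∃ N, N = ∑ k : Fin n, (k : ℕ) * α k := ⟨_, rfl⟩
  induction N using Nat.strong_induction_on generalizing α with
  | _ N ih =>
    subst hN
    by_cases h : ∃ p, IsAscent α p
    · obtain ⟨p, hp⟩ := h
      rw [keyPoly_of_ascent α p hp, ← ih _ (weight_swap_lt hp) _ rfl,
        ← hK.of_descent _ _ _ hp.1 (by simpa using hp.2), comp_swap_swap]
    · rw [hK.of_antitone _ (antitone_of_not_isAscent h),
        (isKeyFamily_keyPoly n).of_antitone _ (antitone_of_not_isAscent h)]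

end KeyFamily

/-! ### Partitions and multi-symmetric Schur polynomials -/

/-- The set of all partitions. -/
abbrev Par : Type := Σ d : ℕ, Nat.Partition d

/-- The parts of a partition in weakly decreasing order, extended by zeros:
`part μ k` is `μ_{k+1}`. -/
def part (μ : Par) (k : ℕ) : ℕ :=
  (μ.2.parts.sort (· ≥ ·)).getD k 0

/-- The composition `(0^{n_1-ℓ(μ^{(1)})} * rev(μ^{(1)})) * ⋯ * (0^{n_r-ℓ(μ^{(r)})} * rev(μ^{(r)}))`
of length `n_1 + ⋯ + n_r` (meaningful when `n_i ≥ ℓ(μ^{(i)})` for all `i`). The equivalence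
`finSigmaFinEquiv` lists the positions of the first window, then those of the second one, and so
on; the entries of the `i`-th window are `μ^{(i)}_{n_i}, …, μ^{(i)}_2, μ^{(i)}_1`. -/
def windowComp {r : ℕ} (μ : Fin r → Par) (n : Fin r → ℕ) : Fin (∑ i, n i) → ℕ :=
  fun k =>
    let p := finSigmaFinEquiv.symm k
    part (μ p.1) (Fin.rev p.2)

/-- The multi-symmetric Schur polynomial: the key polynomial of `windowComp μ n` in the variables
`x_{1,1}, …, x_{1,n_1}, …, x_{r,1}, …, x_{r,n_r}`, where `x_{i+1,j+1}` is the variable `(i, j)`. -/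
def multiSchurPoly {r : ℕ} (μ : Fin r → Par) (n : Fin r → ℕ) : MvPolynomial (Fin r × ℕ) ℤ :=
  MvPolynomial.rename
    (fun k => ((finSigmaFinEquiv.symm k).1, ((finSigmaFinEquiv.symm k).2 : ℕ)))
    (keyPoly ℤ (∑ i, n i) (windowComp μ n))

/-- The multi-symmetric Schur function: the limit, as `n_1, …, n_r → ∞`, of the multi-symmetric
Schur polynomials in the ring of formal power series (coefficientwise convergence, the
coefficients being discrete). -/
def multiSchur {r : ℕ} (μ : Fin r → Par) : MvPowerSeries (Fin r × ℕ) ℤ :=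
  limUnder atTop fun n : Fin r → ℕ => (multiSchurPoly μ n : MvPowerSeries (Fin r × ℕ) ℤ)

/-! ### Rings of symmetric and multi-symmetric functions -/

/-- The ring `Λ_R(X)` of symmetric functions in `x_1, x_2, …`: the power series of bounded degree
that are invariant under all permutations of the variables. -/
def SymFun (R : Type*) [CommRing R] : Subalgebra R (MvPowerSeries ℕ R) where
  carrier := {f | (∀ w : Equiv.Perm ℕ, MvPowerSeries.rename w f = f) ∧
    ∃ d : ℕ, ∀ m : ℕ →₀ ℕ, MvPowerSeries.coeff m f ≠ 0 → m.degree ≤ d}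
  mul_mem' := by
    classical
    rintro f g ⟨hf, d, hd⟩ ⟨hg, e, he⟩
    refine ⟨fun w => by rw [map_mul, hf, hg], d + e, fun m hm => ?_⟩
    rw [MvPowerSeries.coeff_mul] at hm
    obtain ⟨p, hp, hne⟩ := Finset.exists_ne_zero_of_sum_ne_zero hm
    rw [← Finset.HasAntidiagonal.mem_antidiagonal.1 hp, map_add]
    exact add_le_add (hd _ (left_ne_zero_of_mul hne)) (he _ (right_ne_zero_of_mul hne))
  add_mem' := by
    rintro f g ⟨hf, d, hd⟩ ⟨hg, e, he⟩
    refine ⟨fun w => by rw [map_add, hf, hg], max d e, fun m hm => ?_⟩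
    by_cases h : MvPowerSeries.coeff m f = 0
    · exact le_max_of_le_right (he m fun h' => hm (by rw [map_add, h, h', add_zero]))
    · exact le_max_of_le_left (hd m h)
  algebraMap_mem' a := by
    classical
    refine ⟨fun w => AlgHom.commutes _ a, 0, fun m hm => ?_⟩
    rw [MvPowerSeries.algebraMap_apply, MvPowerSeries.coeff_C] at hm
    have : m = 0 := by
      by_contra h
      simp [h] at hm
    simp [this]

/-- The ring `Λ_R(X_1|⋯|X_r) = Λ_R(X_1) ⊗_R ⋯ ⊗_R Λ_R(X_r)` of multi-symmetric functions. -/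
abbrev MultiSymFun (R : Type*) [CommRing R] (r : ℕ) : Type _ :=
  ⨂[R] _i : Fin r, SymFun R

instance tendstoCofinite_prodMk {r : ℕ} (i : Fin r) :
    TendstoCofinite (fun j : ℕ => (i, j)) :=
  tendstoCofinite_of_injective (Prod.mk_right_injective i)

/-- Multi-symmetric functions as power series in the variables of all the `X_i`:
`f_1 ⊗ ⋯ ⊗ f_r ↦ f_1(X_1) ⋯ f_r(X_r)`. -/
def toPowerSeries (R : Type*) [CommRing R] (r : ℕ) :
    MultiSymFun R r →ₐ[R] MvPowerSeries (Fin r × ℕ) R :=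
  PiTensorProduct.liftAlgHom
    ((MultilinearMap.mkPiAlgebra R (Fin r) (MvPowerSeries (Fin r × ℕ) R)).compLinearMap
      fun i => ((MvPowerSeries.rename fun j : ℕ => (i, j)).comp (SymFun R).val).toLinearMap)
    (by simp)
    (fun f g => by simp [Finset.prod_mul_distrib])

end

end MultiSchur

namespace MultiSchur

noncomputable section

/-! ### Symmetry and restriction of key polynomials -/

section Isobaric

variable {σ R : Type*} [DecidableEq σ] [CommRing R] [IsDomain R]

/-! Three properties of key polynomials carry the proof. Symmetry (`swapVar_keyPoly`): if `α_i ≤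
α_{i+1}`, then `K_α` is symmetric in `x_i` and `x_{i+1}`. Stability (`killCompl_keyPoly`): setting
to zero variables whose entries of `α` vanish gives the key polynomial of the composition with these
entries deleted. Unitriangularity (`keyPoly_sub_monomial_mem`): `K_α` is `x^α` plus monomials `x^β`
with `β` strictly lower in the order `Below`, which compares sums of squares and then the numbers of
large entries in each tail.

The composition defining a multi-symmetric Schur polynomial increases weakly inside every window, so
the polynomial is symmetric in the variables of each window. Enlarging the windows prepends zeros;
killing the new leading variables recovers the smaller polynomial in the last variables, and
symmetry moves these back to the first ones. Hence each coefficient is eventually constant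
(`coeff_multiSchurPoly_eq_of_le`), and in the limit it depends only on the partitions formed by the
rows of the exponent.

Tensor products of monomial symmetric functions form a basis of the multi-symmetric functions, and
the coordinates in it are coefficients of the power series (`coeff_toPowerSeries`). This gives
injectivity. The limits are homogeneous, so only finitely many coordinates are nonzero and the
limits lie in the image. The coordinate of `S_μ` at `ν` is a coefficient of one key polynomial
(`coeff_rowsFinsupp_multiSchur`), so the transition matrix is unitriangular for the well-founded
order given by `rank`, and `exists_basis_of_unitriangular` concludes. -/

theorem isobaric_eq_of_mul_eq {x y : σ} (h : x ≠ y) {f g : MvPolynomial σ R}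
    (hg : (MvPolynomial.X x - MvPolynomial.X y) * g =
      MvPolynomial.X x * f - MvPolynomial.X y * swapVar x y f) : isobaric x y f = g :=
  mul_left_cancel₀ (X_sub_X_ne_zero (R := R) h) ((isobaric_spec x y f).trans hg.symm)

theorem isobaric_add {x y : σ} (h : x ≠ y) (f g : MvPolynomial σ R) :
    isobaric x y (f + g) = isobaric x y f + isobaric x y g := by
  apply isobaric_eq_of_mul_eq h
  rw [map_add]
  linear_combination isobaric_spec x y f + isobaric_spec x y g

theorem isobaric_smul {x y : σ} (h : x ≠ y) (a : R) (f : MvPolynomial σ R) :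
    isobaric x y (a • f) = a • isobaric x y f := by
  apply isobaric_eq_of_mul_eq h
  rw [map_smul, mul_smul_comm, isobaric_spec, mul_smul_comm, mul_smul_comm, smul_sub]

/-- The isobaric divided difference as a linear map. -/
def isobaricLinearMap {x y : σ} (h : x ≠ y) : MvPolynomial σ R →ₗ[R] MvPolynomial σ R where
  toFun := isobaric x y
  map_add' := isobaric_add h
  map_smul' := isobaric_smul h

theorem isobaric_eq_self {x y : σ} (h : x ≠ y) {f : MvPolynomial σ R} (hf : swapVar x y f = f) :
    isobaric x y f = f := by
  apply isobaric_eq_of_mul_eq h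
  rw [hf]
  ring

theorem swapVar_isobaric_comm {a b c d : σ} (hcd : c ≠ d) (hac : a ≠ c) (had : a ≠ d)
    (hbc : b ≠ c) (hbd : b ≠ d) {f : MvPolynomial σ R} (hf : swapVar a b f = f) :
    swapVar a b (isobaric c d f) = isobaric c d f := by
  have hs : swapVar a b (swapVar c d f) = swapVar c d (swapVar a b f) := by
    have : (Equiv.swap a b : σ → σ) ∘ Equiv.swap c d = Equiv.swap c d ∘ Equiv.swap a b := by
      funext z
      simp only [Function.comp_apply, Equiv.swap_apply_def]
      grind
    simp [swapVar, MvPolynomial.rename_rename, this]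
  have h := congrArg (swapVar a b) (isobaric_spec c d f)
  simp only [map_mul, map_sub, swapVar_X_of_ne hac.symm hbc.symm,
    swapVar_X_of_ne had.symm hbd.symm, hs, hf] at h
  exact (isobaric_eq_of_mul_eq hcd h).symm

end Isobaric

/-! ### Setting variables to zero. -/

section Restriction

variable {R : Type*} [CommRing R]

theorem swapVar_prod_X_pow {n : ℕ} (α : Fin n → ℕ) (i j : Fin n) (h : α i = α j) :
    swapVar i j (∏ k, MvPolynomial.X k ^ α k : MvPolynomial (Fin n) R) =
      ∏ k, MvPolynomial.X k ^ α k := by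
  simp only [swapVar, map_prod, map_pow, MvPolynomial.rename_X]
  refine Fintype.prod_equiv (Equiv.swap i j) _ _ fun k => ?_
  congr 1
  rw [Equiv.swap_apply_def]
  split_ifs with h1 h2
  · rw [h1, h]
  · rw [h2, h]
  · rfl

theorem killCompl_X_apply {σ τ : Type*} {e : σ → τ} (he : Function.Injective e) (k : σ) :
    MvPolynomial.killCompl he (MvPolynomial.X (e k) : MvPolynomial τ R) = MvPolynomial.X k := by
  rw [← MvPolynomial.rename_X, MvPolynomial.killCompl_rename_app]

theorem killCompl_X_of_notMem {σ τ : Type*} {e : σ → τ} (he : Function.Injective e) {t : τ}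
    (ht : t ∉ Set.range e) :
    MvPolynomial.killCompl he (MvPolynomial.X t : MvPolynomial τ R) = 0 := by
  simp [MvPolynomial.killCompl, ht]

theorem killCompl_swapVar {σ τ : Type*} [DecidableEq σ] [DecidableEq τ] {e : σ → τ}
    (he : Function.Injective e) (k l : σ) (f : MvPolynomial τ R) :
    MvPolynomial.killCompl he (swapVar (e k) (e l) f) =
      swapVar k l (MvPolynomial.killCompl he f) := by
  suffices H : (MvPolynomial.killCompl he).comp (swapVar (R := R) (e k) (e l)) =
      (swapVar k l).comp (MvPolynomial.killCompl he) from DFunLike.congr_fun H f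
  apply MvPolynomial.algHom_ext
  intro z
  simp only [AlgHom.comp_apply, swapVar, MvPolynomial.rename_X]
  by_cases hz : z ∈ Set.range e
  · obtain ⟨w, rfl⟩ := hz
    rw [he.swap_apply, killCompl_X_apply, killCompl_X_apply, MvPolynomial.rename_X]
  · have h1 : z ≠ e k := fun h => hz ⟨k, h.symm⟩
    have h2 : z ≠ e l := fun h => hz ⟨l, h.symm⟩
    rw [Equiv.swap_apply_of_ne_of_ne h1 h2, killCompl_X_of_notMem he hz, map_zero]

/-- Unlike `killCompl_swapVar`, this also covers an interchange of a killed variable with a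
surviving one. -/
theorem killCompl_swapVar_eq_killCompl_comp {σ τ : Type*} [DecidableEq τ] {e : σ → τ}
    (he : Function.Injective e) (a b : τ) (f : MvPolynomial τ R) :
    MvPolynomial.killCompl he (swapVar a b f) =
      MvPolynomial.killCompl ((Equiv.swap a b).injective.comp he) f := by
  suffices H : (MvPolynomial.killCompl he).comp (swapVar (R := R) a b) =
      MvPolynomial.killCompl ((Equiv.swap a b).injective.comp he) from DFunLike.congr_fun H f
  apply MvPolynomial.algHom_ext
  intro z
  simp only [AlgHom.comp_apply, swapVar, MvPolynomial.rename_X]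
  by_cases hz : Equiv.swap a b z ∈ Set.range e
  · obtain ⟨w, hw⟩ := hz
    have hz' : z = (Equiv.swap a b ∘ e) w := by simp [hw]
    rw [← hw, killCompl_X_apply]
    conv_rhs => rw [hz']
    rw [killCompl_X_apply]
  · rw [killCompl_X_of_notMem he hz, killCompl_X_of_notMem]
    rintro ⟨w, hw⟩
    exact hz ⟨w, by simp [← hw]⟩

end Restriction

/-! ### Symmetry and stability of key polynomials. -/

section KeyPoly

variable {R : Type*} [CommRing R] [IsDomain R] {n : ℕ}

theorem ne_of_val_succ {i j : Fin n} (hij : (i : ℕ) + 1 = j) : i ≠ j := by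
  rintro rfl
  omega

theorem swapVar_keyPoly_of_lt {α : Fin n → ℕ} {i j : Fin n} (hij : (i : ℕ) + 1 = j)
    (h : α i < α j) : swapVar i j (keyPoly R n α) = keyPoly R n α := by
  rw [keyPoly_of_ascent α (i, j) ⟨hij, h⟩]
  exact swapVar_isobaric (ne_of_val_succ hij) _

/-- Induction along an ascent of `α`. An ascent disjoint from `i, j` gives an operator commuting
with the interchange; one that overlaps is handled by the braid relation. -/
theorem swapVar_keyPoly_of_eq {α : Fin n → ℕ} {i j : Fin n} (hij : (i : ℕ) + 1 = j)
    (h : α i = α j) : swapVar i j (keyPoly R n α) = keyPoly R n α := by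
  obtain ⟨N, hN⟩ : ∃ N, N = ∑ k : Fin n, (k : ℕ) * α k := ⟨_, rfl⟩
  induction N using Nat.strong_induction_on generalizing α i j with
  | _ N ih =>
    subst hN
    have hne := ne_of_val_succ hij
    by_cases hex : ∃ p, IsAscent α p
    · obtain ⟨⟨a, b⟩, hp⟩ := hex
      have hab' : (a : ℕ) + 1 = b := hp.1
      have hlt' : α a < α b := hp.2
      have hab := ne_of_val_succ hab'
      have w := weight_swap_lt hp
      rw [keyPoly_of_ascent α _ hp]
      simp only at w ⊢
      by_cases hja : j = a
      · subst hja
        have hib : i ≠ b := fun hh => by subst hh; omega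
        have hp2 : IsAscent (α ∘ Equiv.swap j b) (i, j) := by
          refine ⟨hij, ?_⟩
          simp only [Function.comp_apply, Equiv.swap_apply_left,
            Equiv.swap_apply_of_ne_of_ne hne hib]
          omega
        have w2 := weight_swap_lt hp2
        have hsym := ih _ (w2.trans w) (α := (α ∘ Equiv.swap j b) ∘ Equiv.swap i j) hab' (by
          simp only [Function.comp_apply, Equiv.swap_apply_right,
            Equiv.swap_apply_of_ne_of_ne hib.symm hab.symm,
            Equiv.swap_apply_of_ne_of_ne hne hib]
          exact h) rfl
        rw [keyPoly_of_ascent _ _ hp2]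
        simp only
        -- The inner polynomial is fixed by `ξ_{j,b}`, so `ξ_{j,b} ξ_{i,j}` may be lengthened to a
        -- braid word and rewritten to begin with `ξ_{i,j}`, whose image is symmetric.
        rw [← isobaric_eq_self hab hsym, ← isobaric_braid hne hab hib]
        exact swapVar_isobaric hne _
      by_cases hbi : b = i
      · subst hbi
        have haj : a ≠ j := fun hh => by subst hh; omega
        have hp2 : IsAscent (α ∘ Equiv.swap a b) (b, j) := by
          refine ⟨hij, ?_⟩
          simp only [Function.comp_apply, Equiv.swap_apply_right,
            Equiv.swap_apply_of_ne_of_ne haj.symm hne.symm]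
          omega
        have w2 := weight_swap_lt hp2
        have hsym := ih _ (w2.trans w) (α := (α ∘ Equiv.swap a b) ∘ Equiv.swap b j) hab' (by
          simp only [Function.comp_apply, Equiv.swap_apply_left,
            Equiv.swap_apply_of_ne_of_ne haj.symm hne.symm,
            Equiv.swap_apply_of_ne_of_ne hab haj]
          exact h) rfl
        rw [keyPoly_of_ascent _ _ hp2]
        simp only
        rw [← isobaric_eq_self hab hsym, isobaric_braid hab hne haj]
        exact swapVar_isobaric hne _
      have hia : i ≠ a := fun hh => by
        have : j = b := Fin.ext (by rw [← hij, ← hab', hh])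
        subst hh this
        omega
      have hjb : j ≠ b := fun hh => hia (Fin.ext (by rw [hh] at hij; omega))
      refine swapVar_isobaric_comm hab hia (Ne.symm hbi) hja hjb (ih _ w hij ?_ rfl)
      simp only [Function.comp_apply, Equiv.swap_apply_of_ne_of_ne hia (Ne.symm hbi),
        Equiv.swap_apply_of_ne_of_ne hja hjb, h]
    · rw [(isKeyFamily_keyPoly n).of_antitone _ (antitone_of_not_isAscent hex)]
      exact swapVar_prod_X_pow α i j h

theorem swapVar_keyPoly {α : Fin n → ℕ} {i j : Fin n} (hij : (i : ℕ) + 1 = j)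
    (h : α i ≤ α j) : swapVar i j (keyPoly R n α) = keyPoly R n α :=
  h.lt_or_eq.elim (swapVar_keyPoly_of_lt hij) (swapVar_keyPoly_of_eq hij)

/-- Setting to zero variables at which the exponent vanishes deletes these entries from the
composition. -/
theorem killCompl_keyPoly {m : ℕ} {e : Fin m → Fin n} (he : StrictMono e) {α : Fin n → ℕ}
    (hα : ∀ k, k ∉ Set.range e → α k = 0) :
    MvPolynomial.killCompl he.injective (keyPoly R n α) = keyPoly R m (α ∘ e) := by
  obtain ⟨N, hN⟩ : ∃ N, N = ∑ k : Fin n, (k : ℕ) * α k := ⟨_, rfl⟩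
  induction N using Nat.strong_induction_on generalizing α e with
  | _ N ih =>
    subst hN
    by_cases hex : ∃ p, IsAscent α p
    · obtain ⟨⟨a, b⟩, hp⟩ := hex
      have hab' : (a : ℕ) + 1 = b := hp.1
      have hlt : α a < α b := hp.2
      have hab := ne_of_val_succ hab'
      have w := weight_swap_lt hp
      rw [keyPoly_of_ascent α _ hp]
      simp only at w ⊢
      -- The upper end of an ascent is a positive entry, so it is never deleted.
      have hb : b ∈ Set.range e := by
        by_contra hb
        rw [hα b hb] at hlt
        omega
      obtain ⟨l, rfl⟩ := hb
      have spec := congrArg (MvPolynomial.killCompl he.injective)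
        (isobaric_spec a (e l) (keyPoly R n (α ∘ Equiv.swap a (e l))))
      simp only [map_mul, map_sub, killCompl_X_apply] at spec
      by_cases ha : a ∈ Set.range e
      · obtain ⟨k, rfl⟩ := ha
        have hkl : k < l := he.lt_iff_lt.1 (Fin.lt_def.2 (by omega))
        have hkl' : (k : ℕ) + 1 = l := by
          by_contra hne
          have hlt := Fin.lt_def.1 hkl
          let c : Fin m := ⟨k + 1, by omega⟩
          have h1 : e k < e c := he (Fin.lt_def.2 (by simp [c]))
          have h2 : e c < e l := he (Fin.lt_def.2 (by simp only [c]; omega))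
          have h1 := Fin.lt_def.1 h1
          have h2 := Fin.lt_def.1 h2
          omega
        rw [killCompl_X_apply, killCompl_swapVar] at spec
        rw [← isobaric_eq_of_mul_eq hkl.ne spec, ih _ w he (fun z hz => ?_) rfl]
        · have hc : (α ∘ Equiv.swap (e k) (e l)) ∘ e = (α ∘ e) ∘ Equiv.swap k l := by
            funext z
            simp [he.injective.swap_apply]
          rw [hc, keyPoly_of_ascent (α ∘ e) (k, l) ⟨hkl', hlt⟩]
        · rw [Function.comp_apply, Equiv.swap_apply_of_ne_of_ne (fun h => hz ⟨k, h.symm⟩)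
            (fun h => hz ⟨l, h.symm⟩), hα z hz]
      -- With `x_a = 0` the defining identity of `ξ` becomes `-x_b ξ f = -x_b s f`, so `ξ` acts as
      -- the interchange. This amounts to letting the embedding hit `a` instead of `b = a + 1`,
      -- which stays increasing because `e` skips `a`.
      · rw [killCompl_X_of_notMem he.injective ha, killCompl_swapVar_eq_killCompl_comp] at spec
        have he' : StrictMono (Equiv.swap a (e l) ∘ e) := by
          have hne : ∀ k, e k ≠ a := fun k h => ha ⟨k, h⟩
          intro u v huv
          have huv := he huv
          have hu := hne u
          have hv := hne v
          simp only [Function.comp_apply, Equiv.swap_apply_def, if_neg hu, if_neg hv]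
          rw [Ne, Fin.ext_iff] at hu hv
          rw [Fin.lt_def] at huv
          split_ifs with h1 h2 h2
          · rw [h1, h2] at huv
            omega
          · rw [Fin.lt_def]; rw [h1] at huv; omega
          · rw [Fin.lt_def]; rw [h2] at huv; omega
          · exact huv
        have hX : (MvPolynomial.X l : MvPolynomial (Fin m) R) ≠ 0 := MvPolynomial.X_ne_zero l
        have key : MvPolynomial.killCompl he.injective
            (isobaric a (e l) (keyPoly R n (α ∘ Equiv.swap a (e l)))) =
            MvPolynomial.killCompl he'.injective (keyPoly R n (α ∘ Equiv.swap a (e l))) := by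
          refine mul_left_cancel₀ hX ?_
          linear_combination -spec
        rw [key, ih _ w he' (fun z hz => ?_) rfl]
        · congr 1
          funext z
          simp
        · refine hα _ fun ⟨k, hk⟩ => hz ⟨k, by simp [hk]⟩
    · have hanti := antitone_of_not_isAscent hex
      rw [(isKeyFamily_keyPoly n).of_antitone _ hanti,
        (isKeyFamily_keyPoly m).of_antitone _ (hanti.comp_monotone he.monotone), map_prod]
      simp only [map_pow]
      refine (Finset.prod_subset (Finset.subset_univ (Finset.univ.map ⟨e, he.injective⟩))
        fun k _ hk => ?_).symm.trans ?_
      · rw [hα k (by simpa using hk), pow_zero]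
      · rw [Finset.prod_map]
        simp [killCompl_X_apply]

end KeyPoly

/-! ### Isobaric divided differences of monomials -/

theorem monomial_mul_X_pow_mul_X_pow {σ R : Type*} [CommRing R] (x y : σ) (ρ : σ →₀ ℕ) (a b : ℕ) :
    MvPolynomial.monomial ρ (1 : R) * (MvPolynomial.X x ^ a * MvPolynomial.X y ^ b) =
      MvPolynomial.monomial (ρ + (Finsupp.single x a + Finsupp.single y b)) 1 := by
  rw [MvPolynomial.X_pow_eq_monomial, MvPolynomial.X_pow_eq_monomial,
    MvPolynomial.monomial_mul, MvPolynomial.monomial_mul, one_mul, one_mul]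

section Monomials

variable {σ R : Type*} [DecidableEq σ] [CommRing R]

theorem swapVar_monomial_of_eq_zero {x y : σ} {ρ : σ →₀ ℕ} (hx : ρ x = 0) (hy : ρ y = 0) :
    swapVar x y (MvPolynomial.monomial ρ (1 : R)) = MvPolynomial.monomial ρ 1 := by
  rw [swapVar, MvPolynomial.rename_monomial]
  refine congrArg (fun s => MvPolynomial.monomial s (1 : R)) (Finsupp.ext fun z => ?_)
  rw [Finsupp.mapDomain_equiv_apply, Equiv.symm_swap, Equiv.swap_apply_def]
  split_ifs with h1 h2
  · rw [h1, hx, hy]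
  · rw [h2, hx, hy]
  · rfl

variable [IsDomain R]

/-- The factors `x^ρ` and `(x y)^q` are symmetric and come out of `ξ`; what remains is the geometric
sum `(x^{d+1} - y^{d+1}) / (x - y)`. -/
theorem isobaric_monomial_of_le {x y : σ} (h : x ≠ y) {ρ : σ →₀ ℕ} (hx : ρ x = 0) (hy : ρ y = 0)
    (q d : ℕ) :
    isobaric x y (MvPolynomial.monomial (ρ + (Finsupp.single x (q + d) + Finsupp.single y q))
        (1 : R)) =
      ∑ k ∈ Finset.range (d + 1), MvPolynomial.monomial
        (ρ + (Finsupp.single x (q + k) + Finsupp.single y (q + (d - k)))) 1 := by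
  apply isobaric_eq_of_mul_eq h
  simp only [← monomial_mul_X_pow_mul_X_pow, map_mul, map_pow, swapVar_X_left, swapVar_X_right,
    swapVar_monomial_of_eq_zero hx hy]
  have hg := geom_sum₂_mul (MvPolynomial.X x : MvPolynomial σ R) (MvPolynomial.X y) (d + 1)
  have hs : ∑ k ∈ Finset.range (d + 1), MvPolynomial.monomial ρ (1 : R) *
      (MvPolynomial.X x ^ (q + k) * MvPolynomial.X y ^ (q + (d - k))) =
      MvPolynomial.monomial ρ 1 * (MvPolynomial.X x * MvPolynomial.X y) ^ q *
      ∑ k ∈ Finset.range (d + 1), MvPolynomial.X x ^ k * MvPolynomial.X y ^ (d + 1 - 1 - k) := by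
    rw [Finset.mul_sum]
    refine Finset.sum_congr rfl fun k _ => ?_
    rw [Nat.add_sub_cancel]
    ring
  rw [hs]
  linear_combination
    MvPolynomial.monomial ρ (1 : R) * (MvPolynomial.X x * MvPolynomial.X y) ^ q * hg

/-- The same geometric sum with the opposite sign; it is empty when the exponents differ by one (`d
= 0`). -/
theorem isobaric_monomial_of_lt {x y : σ} (h : x ≠ y) {ρ : σ →₀ ℕ} (hx : ρ x = 0) (hy : ρ y = 0)
    (p d : ℕ) :
    isobaric x y (MvPolynomial.monomial
        (ρ + (Finsupp.single x p + Finsupp.single y (p + 1 + d))) (1 : R)) =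
      -∑ k ∈ Finset.range d, MvPolynomial.monomial
        (ρ + (Finsupp.single x (p + 1 + k) + Finsupp.single y (p + 1 + (d - 1 - k)))) 1 := by
  apply isobaric_eq_of_mul_eq h
  simp only [← monomial_mul_X_pow_mul_X_pow, map_mul, map_pow, swapVar_X_left, swapVar_X_right,
    swapVar_monomial_of_eq_zero hx hy]
  have hg := geom_sum₂_mul (MvPolynomial.X x : MvPolynomial σ R) (MvPolynomial.X y) d
  have hs : ∑ k ∈ Finset.range d, MvPolynomial.monomial ρ (1 : R) *
      (MvPolynomial.X x ^ (p + 1 + k) * MvPolynomial.X y ^ (p + 1 + (d - 1 - k))) =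
      MvPolynomial.monomial ρ 1 * (MvPolynomial.X x * MvPolynomial.X y) ^ (p + 1) *
      ∑ k ∈ Finset.range d, MvPolynomial.X x ^ k * MvPolynomial.X y ^ (d - 1 - k) := by
    rw [Finset.mul_sum]
    refine Finset.sum_congr rfl fun k _ => ?_
    ring
  rw [hs]
  linear_combination
    - MvPolynomial.monomial ρ (1 : R) * (MvPolynomial.X x * MvPolynomial.X y) ^ (p + 1) * hg

theorem exists_eq_add_single_add_single {x y : σ} (h : x ≠ y) (β : σ →₀ ℕ) :
    ∃ ρ : σ →₀ ℕ, ρ x = 0 ∧ ρ y = 0 ∧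
      β = ρ + (Finsupp.single x (β x) + Finsupp.single y (β y)) := by
  refine ⟨(β.erase x).erase y, by simp [h], by simp, ?_⟩
  ext z
  by_cases hx : z = x
  · subst hx; simp [h]
  · by_cases hy : z = y
    · subst hy; simp [h]
    · simp [hx, hy]

/-- The monomials in `ξ_{x,y} x^β`: the exponents of `x` and `y` lie between those of `β`, and
strictly between them if the exponent of `x` in `β` is smaller than that of `y`. -/
structure IsTerm (x y : σ) (β γ : σ →₀ ℕ) : Prop where
  apply_of_ne : ∀ z, z ≠ x → z ≠ y → γ z = β z
  add_eq : γ x + γ y = β x + β y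
  between : β y ≤ γ x ∧ γ x ≤ β x ∨ β x < γ x ∧ γ x < β y

theorem isobaric_monomial_mem {x y : σ} (h : x ≠ y) (β : σ →₀ ℕ) :
    isobaric x y (MvPolynomial.monomial β (1 : R)) ∈
      MvPolynomial.restrictSupport R {γ | IsTerm x y β γ} := by
  obtain ⟨ρ, hx, hy, hβ⟩ := exists_eq_add_single_add_single h β
  obtain hle | hlt := le_or_gt (β y) (β x)
  · obtain ⟨d, hd⟩ := Nat.exists_eq_add_of_le hle
    rw [hd] at hβ
    rw [hβ, isobaric_monomial_of_le h hx hy]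
    refine Submodule.sum_mem _ fun k hk => ?_
    rw [MvPolynomial.monomial_mem_restrictSupport]
    have hk := Finset.mem_range.1 hk
    refine Or.inl ⟨fun z h1 h2 => by simp [h1, h2], ?_, Or.inl ?_⟩ <;> simp [h, h.symm, hx, hy] <;>
      omega
  · obtain ⟨d, hd⟩ := Nat.exists_eq_add_of_lt hlt
    rw [show β x + d + 1 = β x + 1 + d by ring] at hd
    rw [hd] at hβ
    rw [hβ, isobaric_monomial_of_lt h hx hy]
    refine Submodule.neg_mem _ (Submodule.sum_mem _ fun k hk => ?_)
    rw [MvPolynomial.monomial_mem_restrictSupport]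
    have hk := Finset.mem_range.1 hk
    refine Or.inl ⟨fun z h1 h2 => by simp [h1, h2], ?_, Or.inr ?_⟩ <;> simp [h, h.symm, hx, hy] <;>
      omega

theorem isobaric_monomial_sub_mem {x y : σ} (h : x ≠ y) (β : σ →₀ ℕ) (hle : β y ≤ β x) :
    isobaric x y (MvPolynomial.monomial β (1 : R)) -
        MvPolynomial.monomial (β.mapDomain (Equiv.swap x y)) 1 ∈
      MvPolynomial.restrictSupport R
        {γ | IsTerm x y β γ ∧ γ ≠ β.mapDomain (Equiv.swap x y)} := by
  obtain ⟨ρ, hx, hy, hβ⟩ := exists_eq_add_single_add_single h β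
  obtain ⟨d, hd⟩ := Nat.exists_eq_add_of_le hle
  rw [hd] at hβ
  have hsw : β.mapDomain (Equiv.swap x y) =
      ρ + (Finsupp.single x (β y + 0) + Finsupp.single y (β y + (d - 0))) := by
    ext z
    rw [Finsupp.mapDomain_equiv_apply, Equiv.symm_swap, Equiv.swap_apply_def]
    split_ifs with h1 h2
    · subst h1; simp [h, hx]
    · subst h2; simp [h, hy, hd]
    · rw [hβ]; simp [h1, h2]
  have hξ := isobaric_monomial_of_le (R := R) h hx hy (β y) d
  rw [← hβ] at hξ
  -- The summand `k = 0` is the interchanged monomial, which is split off and cancelled.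
  rw [hξ, hsw, Finset.sum_range_succ', add_sub_cancel_right]
  refine Submodule.sum_mem _ fun k hk => ?_
  rw [MvPolynomial.monomial_mem_restrictSupport]
  have hk := Finset.mem_range.1 hk
  refine Or.inl ⟨⟨fun z h1 h2 => ?_, ?_, Or.inl ?_⟩, fun hh => ?_⟩
  · rw [hβ]; simp [h1, h2]
  · simp [h, h.symm, hx, hy]; omega
  · simp [h, hx]; omega
  · have := DFunLike.congr_fun hh x
    simp [h, hx] at this

end Monomials

/-! ### The leading monomial of a key polynomial -/

section LeadingTerm

variable {n : ℕ}

/-- The number of entries of `β` from position `k` on that are at least `t`. -/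
def tailCount (β : Fin n → ℕ) (k t : ℕ) : ℕ :=
  ∑ l : Fin n, if k ≤ l ∧ t ≤ β l then 1 else 0

/-- The triangularity order on compositions. -/
structure Below (β α : Fin n → ℕ) : Prop where
  sum_eq : ∑ l, β l = ∑ l, α l
  lt_or_le : ∑ l, β l ^ 2 < ∑ l, α l ^ 2 ∨
    ∑ l, β l ^ 2 = ∑ l, α l ^ 2 ∧ ∀ k t, tailCount β k t ≤ tailCount α k t

theorem Below.refl (α : Fin n → ℕ) : Below α α := ⟨rfl, Or.inr ⟨rfl, fun _ _ => le_rfl⟩⟩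

theorem sum_eq_add_add_sum_erase {i j : Fin n} (h : i ≠ j) (f : Fin n → ℕ) :
    ∑ l, f l = f i + f j + ∑ l ∈ (Finset.univ.erase i).erase j, f l := by
  rw [add_assoc, Finset.add_sum_erase _ _ (Finset.mem_erase.2 ⟨h.symm, Finset.mem_univ j⟩),
    Finset.add_sum_erase _ _ (Finset.mem_univ i)]

/-- By convexity, moving two numbers of fixed sum strictly inside their interval lowers the sum of
squares. Equality leaves only `β` and its interchange, and these occur only when `β j ≤ β i`. -/
theorem IsTerm.sum_sq_lt_or_eq {β γ : Fin n →₀ ℕ} {i j : Fin n} (hne : i ≠ j)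
    (hγ : IsTerm i j β γ) :
    ∑ l, γ l ^ 2 < ∑ l, β l ^ 2 ∨ ∑ l, γ l ^ 2 = ∑ l, β l ^ 2 ∧ β j ≤ β i ∧
      (γ i = β i ∧ γ j = β j ∨ γ i = β j ∧ γ j = β i) := by
  obtain ⟨hoff, hadd, hbet⟩ := hγ
  have hoff' : ∀ l ∈ (Finset.univ.erase i).erase j, γ l = β l := fun l hl => by
    simp only [Finset.mem_erase] at hl
    exact hoff l hl.2.1 hl.1
  rw [sum_eq_add_add_sum_erase hne, sum_eq_add_add_sum_erase hne fun l => β l ^ 2,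
    Finset.sum_congr rfl fun l hl => by rw [hoff' l hl]]
  by_cases h1 : γ i = β i
  · exact Or.inr ⟨by rw [h1, show γ j = β j by omega], by omega, Or.inl ⟨h1, by omega⟩⟩
  by_cases h2 : γ i = β j
  · exact Or.inr ⟨by rw [h2, show γ j = β i by omega, add_comm (β j ^ 2)], by omega,
      Or.inr ⟨h2, by omega⟩⟩
  left
  rw [add_lt_add_iff_right]
  rcases hbet with hb | hb
  · obtain ⟨u, hu⟩ := Nat.exists_eq_add_of_lt (show β j < γ i by omega)
    obtain ⟨v, hv⟩ := Nat.exists_eq_add_of_lt (show γ i < β i by omega)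
    have hj : γ j = β j + v + 1 := by omega
    rw [hv, hj, hu]
    nlinarith
  · obtain ⟨u, hu⟩ := Nat.exists_eq_add_of_lt hb.1
    obtain ⟨v, hv⟩ := Nat.exists_eq_add_of_lt hb.2
    have hj : γ j = β i + v + 1 := by omega
    rw [hv, hj, hu]
    nlinarith

/-- The induction step for triangularity: `ξ_i` carries monomials below `α` to monomials below `s_i
α`. If the squares do not decide, `γ` is `β` or its interchange, and only the tail starting at `j`
separates the two positions. -/
theorem Below.isTerm {α : Fin n → ℕ} {β γ : Fin n →₀ ℕ} {i j : Fin n} (hij : (i : ℕ) + 1 = j)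
    (hα : α j < α i) (h : Below β α) (hγ : IsTerm i j β γ) :
    Below γ (α ∘ Equiv.swap i j) := by
  have hne := ne_of_val_succ hij
  have hsq' := hγ.sum_sq_lt_or_eq hne
  obtain ⟨hoff, hadd, hbet⟩ := hγ
  have hoff' : ∀ l ∈ (Finset.univ.erase i).erase j, γ l = β l := fun l hl => by
    simp only [Finset.mem_erase] at hl
    exact hoff l hl.2.1 hl.1
  have hswap : ∀ l ∈ (Finset.univ.erase i).erase j, (α ∘ Equiv.swap i j) l = α l := fun l hl => by
    simp only [Finset.mem_erase] at hl
    simp [Equiv.swap_apply_of_ne_of_ne hl.2.1 hl.1]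
  have hsum : ∑ l, (α ∘ Equiv.swap i j) l = ∑ l, α l := Equiv.sum_comp _ α
  have hsq : ∑ l, (α ∘ Equiv.swap i j) l ^ 2 = ∑ l, α l ^ 2 :=
    Equiv.sum_comp (Equiv.swap i j) fun l => α l ^ 2
  refine ⟨?_, ?_⟩
  · rw [hsum, ← h.sum_eq, sum_eq_add_add_sum_erase hne, sum_eq_add_add_sum_erase hne (β : Fin n → ℕ),
      hadd, Finset.sum_congr rfl hoff']
  · rw [hsq]
    rcases hsq' with h1 | ⟨h1, hle, hcase⟩
    · left
      rcases h.lt_or_le with h2 | ⟨h2, -⟩ <;> omega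
    rcases h.lt_or_le with h2 | ⟨h2, hN⟩
    · left; omega
    right
    refine ⟨by omega, fun k t => ?_⟩
    let rest (f : Fin n → ℕ) (k : ℕ) : ℕ :=
      ∑ l ∈ (Finset.univ.erase i).erase j, if k ≤ l ∧ t ≤ f l then 1 else 0
    have split : ∀ (f : Fin n → ℕ) (k : ℕ), tailCount f k t =
        (if k ≤ i ∧ t ≤ f i then 1 else 0) + (if k ≤ j ∧ t ≤ f j then 1 else 0) + rest f k :=
      fun f k => sum_eq_add_add_sum_erase hne _
    have hrestγ : rest γ k = rest β k := Finset.sum_congr rfl fun l hl => by rw [hoff' l hl]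
    have hrestα : rest (α ∘ Equiv.swap i j) k = rest α k :=
      Finset.sum_congr rfl fun l hl => by rw [hswap l hl]
    have shift : ∀ (f : Fin n → ℕ) (k : ℕ), (k = i ∨ k = j + 1) → rest f k = rest f j := by
      intro f k hk
      refine Finset.sum_congr rfl fun l hl => ?_
      simp only [Finset.mem_erase, Finset.mem_univ, and_true, Ne, Fin.ext_iff] at hl
      congr 1
      simp only [eq_iff_iff, and_congr_left_iff]
      intro _
      omega
    -- For the critical tail `k = j`, the inequality follows from those for the tails starting at
    -- `i` and at `j + 1`, between which all three tails agree away from `i` and `j`.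
    have hNi := hN i t
    have hNk := hN k t
    have hNj := hN (j + 1) t
    rw [split, split α] at hNi hNk hNj
    rw [shift _ _ (Or.inl rfl), shift _ _ (Or.inl rfl)] at hNi
    rw [shift _ _ (Or.inr rfl), shift _ _ (Or.inr rfl)] at hNj
    rw [split, split (α ∘ _), hrestγ, hrestα]
    simp only [Function.comp_apply, Equiv.swap_apply_left, Equiv.swap_apply_right]
    clear_value rest
    clear split hrestγ hrestα shift hsum hsq hoff' hswap hoff hN h1 h2 h hbet
    rcases lt_trichotomy k j with hk | rfl | hk
    · clear hNi hNj
      simp only [show k ≤ i by omega, hk.le, true_and] at hNk ⊢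
      rcases hcase with ⟨h1, h2⟩ | ⟨h1, h2⟩ <;> rw [h1, h2] <;> omega
    · clear hNk
      simp only [le_refl, true_and, show (i : ℕ) ≤ j by omega, show ¬ (j : ℕ) ≤ i by omega,
        show ¬ (j : ℕ) + 1 ≤ i by omega, show ¬ (j : ℕ) + 1 ≤ j by omega, false_and,
        if_false] at hNi hNj ⊢
      rcases hcase with ⟨h1, h2⟩ | ⟨h1, h2⟩ <;> rw [h2] <;> clear h1 h2 hadd
      · by_cases h1 : t ≤ β j
        · simp only [h1, show t ≤ β i by omega, if_true] at hNi ⊢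
          split_ifs at hNi ⊢ <;> omega
        · simp only [h1, if_false]
          omega
      · by_cases h1 : t ≤ α i
        · simp only [h1, if_true]
          split_ifs <;> omega
        · simp only [h1, show ¬ t ≤ α j by omega, if_false] at hNi ⊢
          omega
    · clear hNi hNj
      simpa only [show ¬ k ≤ i by omega, not_le.2 hk, false_and, if_false] using hNk

/-- Consecutive tail counts differ by the indicator of `t ≤ f k`, which over all `t > 0` determines
`f k`. Thresholds up to the total sum suffice, since it bounds every entry. -/
theorem eq_of_tailCount_eq {β α : Fin n → ℕ}
    (h : ∀ (k : Fin (n + 1)) (t : ℕ), 0 < t → t ≤ ∑ l, (β l + α l) →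
      tailCount β k t = tailCount α k t) : β = α := by
  have step : ∀ (f : Fin n → ℕ) (k : Fin n) (t : ℕ),
      tailCount f k t = (if t ≤ f k then 1 else 0) + tailCount f (k + 1) t := by
    intro f k t
    rw [tailCount, tailCount, ← Finset.add_sum_erase _ _ (Finset.mem_univ k),
      ← Finset.add_sum_erase _ (fun l : Fin n => if (k : ℕ) + 1 ≤ l ∧ t ≤ f l then 1 else 0)
        (Finset.mem_univ k)]
    simp only [le_refl, true_and, add_le_iff_nonpos_right, nonpos_iff_eq_zero, one_ne_zero,
      false_and, if_false, zero_add]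
    congr 1
    refine Finset.sum_congr rfl fun l hl => ?_
    simp only [Finset.mem_erase, Finset.mem_univ, and_true, Ne, Fin.ext_iff] at hl
    congr 1
    simp only [eq_iff_iff, and_congr_left_iff]
    intro _
    omega
  funext k
  have hB : β k + α k ≤ ∑ l, (β l + α l) :=
    Finset.single_le_sum (f := fun l => β l + α l) (fun _ _ => Nat.zero_le _) (Finset.mem_univ k)
  have key : ∀ t, 0 < t → t ≤ ∑ l, (β l + α l) → (t ≤ β k ↔ t ≤ α k) := by
    intro t ht htB
    have h1 := h k.castSucc t ht htB
    have h2 := h k.succ t ht htB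
    simp only [Fin.val_castSucc, Fin.val_succ] at h1 h2
    rw [step, step, h2, add_left_inj] at h1
    grind
  apply le_antisymm
  · rcases Nat.eq_zero_or_pos (β k) with h0 | h0
    · omega
    · exact (key _ h0 (by omega)).1 le_rfl
  · rcases Nat.eq_zero_or_pos (α k) with h0 | h0
    · omega
    · exact (key _ h0 (by omega)).2 le_rfl

/-- Position `l` is counted by the `l + 1` tails containing it, and in each by `f l` thresholds.
This turns the pointwise comparison of tail counts into the second component of `rank`. -/
theorem sum_tailCount {f : Fin n → ℕ} {B : ℕ} (hB : ∀ l, f l ≤ B) :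
    ∑ k : Fin (n + 1), ∑ t ∈ Finset.Icc 1 B, tailCount f k t = ∑ l : Fin n, (l + 1) * f l := by
  simp only [tailCount]
  simp_rw [Finset.sum_comm (s := Finset.Icc 1 B)]
  rw [Finset.sum_comm]
  refine Finset.sum_congr rfl fun l _ => ?_
  have h1 : ∀ k : ℕ, (∑ t ∈ Finset.Icc 1 B, if k ≤ l ∧ t ≤ f l then 1 else 0) =
      if k ≤ l then f l else 0 := by
    intro k
    by_cases hk : k ≤ l
    · have : (Finset.Icc 1 B).filter (fun t => t ≤ f l) = Finset.Icc 1 (f l) := by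
        ext t
        simp only [Finset.mem_filter, Finset.mem_Icc]
        have := hB l
        omega
      simp [hk, this]
    · simp [hk]
  simp_rw [h1]
  rw [Fin.sum_univ_eq_sum_range (fun k => if k ≤ (l : ℕ) then f l else 0) (n + 1),
    ← Finset.sum_filter]
  have : (Finset.range (n + 1)).filter (fun k => k ≤ (l : ℕ)) = Finset.range (l + 1) := by
    ext k
    simp only [Finset.mem_filter, Finset.mem_range]
    have := l.2
    omega
  rw [this]
  simp

/-- A numerical measure of the position of a composition in the triangularity order. -/
def rank (α : Fin n → ℕ) : ℕ ×ₗ ℕ := toLex (∑ l, α l ^ 2, ∑ l : Fin n, (l + 1) * α l)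

theorem Below.rank_lt {β α : Fin n → ℕ} (h : Below β α) (hne : β ≠ α) : rank β < rank α := by
  rw [rank, rank, Prod.Lex.toLex_lt_toLex]
  rcases h.lt_or_le with h1 | ⟨h1, h2⟩
  · exact Or.inl h1
  refine Or.inr ⟨h1, ?_⟩
  have hB : ∀ l, β l + α l ≤ ∑ l, (β l + α l) := fun l =>
    Finset.single_le_sum (f := fun l => β l + α l) (fun _ _ => Nat.zero_le _) (Finset.mem_univ l)
  simp only
  rw [← sum_tailCount (B := ∑ l, (β l + α l)) fun l => (Nat.le_add_right _ _).trans (hB l),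
    ← sum_tailCount (B := ∑ l, (β l + α l)) fun l => (Nat.le_add_left _ _).trans (hB l)]
  refine lt_of_le_of_ne (Finset.sum_le_sum fun k _ => Finset.sum_le_sum fun t _ => h2 k t)
    fun heq => hne (eq_of_tailCount_eq fun k t ht htB => ?_)
  have := (Finset.sum_eq_sum_iff_of_le (s := Finset.univ) (ι := Fin (n + 1))
    fun k _ => Finset.sum_le_sum fun t _ => h2 k t).1 heq k (Finset.mem_univ k)
  exact (Finset.sum_eq_sum_iff_of_le fun t _ => h2 k t).1 this t (Finset.mem_Icc.2 ⟨ht, htB⟩)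

variable {R : Type*} [CommRing R] [IsDomain R]

theorem isobaric_mem_restrictSupport {σ : Type*} [DecidableEq σ] {x y : σ} (h : x ≠ y)
    {s t : Set (σ →₀ ℕ)} (hst : ∀ β ∈ s, ∀ γ, IsTerm x y β γ → γ ∈ t)
    {f : MvPolynomial σ R} (hf : f ∈ MvPolynomial.restrictSupport R s) :
    isobaric x y f ∈ MvPolynomial.restrictSupport R t := by
  rw [MvPolynomial.restrictSupport_eq_span] at hf
  change isobaricLinearMap h f ∈ _
  refine (Submodule.span_le (p := (MvPolynomial.restrictSupport R t).comap
    (isobaricLinearMap h))).2 ?_ hf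
  rintro _ ⟨β, hβ, rfl⟩
  exact MvPolynomial.restrictSupport_mono R (fun γ hγ => hst β hβ γ hγ)
    (isobaric_monomial_mem h β)

/-- The key polynomial `K_α` is `x^α` plus a combination of lower monomials. -/
theorem keyPoly_sub_monomial_mem (α : Fin n →₀ ℕ) :
    keyPoly R n α - MvPolynomial.monomial α 1 ∈
      MvPolynomial.restrictSupport R {β | Below β α ∧ β ≠ α} := by
  obtain ⟨N, hN⟩ : ∃ N, N = ∑ k : Fin n, (k : ℕ) * α k := ⟨_, rfl⟩
  induction N using Nat.strong_induction_on generalizing α with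
  | _ N ih =>
    subst hN
    by_cases hex : ∃ p, IsAscent α p
    · obtain ⟨⟨i, j⟩, hp⟩ := hex
      have hij : (i : ℕ) + 1 = j := hp.1
      have hlt : α i < α j := hp.2
      have hne := ne_of_val_succ hij
      obtain ⟨δ, hδ⟩ : ∃ δ : Fin n →₀ ℕ, δ = α.mapDomain (Equiv.swap i j) := ⟨_, rfl⟩
      have hδ' : (δ : Fin n → ℕ) = α ∘ Equiv.swap i j := by
        funext z
        rw [hδ, Finsupp.mapDomain_equiv_apply, Equiv.symm_swap, Function.comp_apply]
      have hα' : (α : Fin n → ℕ) = δ ∘ Equiv.swap i j := by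
        rw [hδ', comp_swap_swap]
      have hα : α = δ.mapDomain (Equiv.swap i j) := by
        ext z
        rw [Finsupp.mapDomain_equiv_apply, Equiv.symm_swap, hα', Function.comp_apply]
      have hδlt : δ j < δ i := by
        rw [hδ']
        simpa using hlt
      have w := weight_swap_lt hp
      simp only at w
      rw [← hδ'] at w
      have IH := ih _ w δ rfl
      rw [keyPoly_of_ascent _ _ hp]
      simp only
      rw [← hδ']
      have e : isobaric i j (keyPoly R n δ) - MvPolynomial.monomial α 1 =
          isobaric i j (keyPoly R n δ - MvPolynomial.monomial δ 1) +
          (isobaric i j (MvPolynomial.monomial δ 1) - MvPolynomial.monomial α 1) := by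
        rw [← add_sub_assoc, ← isobaric_add hne, sub_add_cancel]
      rw [e]
      refine Submodule.add_mem _ (isobaric_mem_restrictSupport hne ?_ IH) ?_
      · rintro β ⟨hβ, hβne⟩ γ hγ
        refine ⟨?_, ?_⟩
        · rw [hα']
          exact hβ.isTerm hij hδlt hγ
        -- If the leading exponent arose from `β`, comparing squares would make it `β` or its
        -- interchange; as its entries at `i, j` increase, it would be the interchange, forcing `β =
        -- δ`.
        · rintro rfl
          have h1 : γ i = δ j := by rw [hα']; simp
          have h2 : γ j = δ i := by rw [hα']; simp
          have hsq : ∑ l, γ l ^ 2 = ∑ l, δ l ^ 2 := by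
            rw [hα']
            exact Equiv.sum_comp (Equiv.swap i j) fun l => δ l ^ 2
          have hle : ∑ l, β l ^ 2 ≤ ∑ l, δ l ^ 2 := hβ.lt_or_le.elim le_of_lt fun h => h.1.le
          rcases hγ.sum_sq_lt_or_eq hne with h3 | ⟨-, h4, h5⟩
          · omega
          refine hβne (Finsupp.ext fun z => ?_)
          by_cases hzi : z = i
          · subst hzi; omega
          by_cases hzj : z = j
          · subst hzj; omega
          rw [← hγ.apply_of_ne z hzi hzj, hα', Function.comp_apply,
            Equiv.swap_apply_of_ne_of_ne hzi hzj]
      · have hmem := isobaric_monomial_sub_mem (R := R) hne δ hδlt.le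
        rw [← hα] at hmem
        refine MvPolynomial.restrictSupport_mono R ?_ hmem
        rintro γ ⟨hγ, hγne⟩
        refine ⟨?_, hγne⟩
        rw [hα']
        exact (Below.refl _).isTerm hij hδlt hγ
    · rw [(isKeyFamily_keyPoly n).of_antitone _ (antitone_of_not_isAscent hex),
        MvPolynomial.monomial_eq, Finsupp.prod_fintype _ _ fun _ => pow_zero _]
      simp

end LeadingTerm

/-! ### Partitions as exponents -/

section Partitions

/-- The parts of a partition as a finitely supported function. -/
def partFinsupp (μ : Par) : ℕ →₀ ℕ :=
  Finsupp.onFinset (Finset.range (μ.2.parts.sort (· ≥ ·)).length) (part μ) fun k hk => by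
    rw [Finset.mem_range]
    by_contra hlen
    exact hk (List.getD_eq_default _ _ (not_lt.1 hlen))

@[simp]
theorem partFinsupp_apply (μ : Par) (k : ℕ) : partFinsupp μ k = part μ k := rfl

theorem part_eq_zero_of_card_le {μ : Par} {k : ℕ} (h : Multiset.card μ.2.parts ≤ k) :
    part μ k = 0 :=
  List.getD_eq_default _ _ (by simpa using h)

theorem part_antitone (μ : Par) : Antitone (part μ) := by
  refine antitone_nat_of_succ_le fun k => ?_
  have hs := (μ.2.parts.pairwise_sort (· ≥ ·))
  rw [part, part]
  by_cases h : k + 1 < (μ.2.parts.sort (· ≥ ·)).length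
  · rw [List.getD_eq_getElem _ _ h, List.getD_eq_getElem _ _ (by omega)]
    exact List.pairwise_iff_getElem.1 hs k (k + 1) (by omega) h (by omega)
  · rw [List.getD_eq_default _ _ (not_lt.1 h)]
    exact Nat.zero_le _

/-- The partition formed by the nonzero values of a finitely supported function. -/
def ofFinsupp (m : ℕ →₀ ℕ) : Par :=
  ⟨(m.support.val.map m).sum,
    { parts := m.support.val.map m
      parts_pos := by
        intro i hi
        obtain ⟨k, hk, rfl⟩ := Multiset.mem_map.1 hi
        exact Nat.pos_of_ne_zero (Finsupp.mem_support_iff.1 hk)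
      parts_sum := rfl }⟩

theorem par_ext {μ ν : Par} (h : μ.2.parts = ν.2.parts) : μ = ν := by
  obtain ⟨d, p, hp, rfl⟩ := μ
  obtain ⟨e, q, hq, rfl⟩ := ν
  simp only at h
  subst h
  rfl

theorem ofFinsupp_eq_iff {m m' : ℕ →₀ ℕ} :
    ofFinsupp m = ofFinsupp m' ↔ m.support.val.map m = m'.support.val.map m' :=
  ⟨fun h => congrArg (fun μ : Par => μ.2.parts) h, fun h => par_ext h⟩

theorem ofFinsupp_partFinsupp (μ : Par) : ofFinsupp (partFinsupp μ) = μ := by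
  apply par_ext
  have hsupp : (partFinsupp μ).support = Finset.range (μ.2.parts.sort (· ≥ ·)).length := by
    ext k
    rw [Finsupp.mem_support_iff, Finset.mem_range, partFinsupp_apply, part]
    constructor
    · intro hk
      by_contra hlen
      exact hk (List.getD_eq_default _ _ (not_lt.1 hlen))
    · intro hk
      rw [List.getD_eq_getElem _ _ hk]
      exact (μ.2.parts_pos ((Multiset.mem_sort _).1 (List.getElem_mem hk))).ne'
  change (partFinsupp μ).support.val.map (partFinsupp μ) = _
  rw [hsupp, Finset.range_val, ← Multiset.coe_range, Multiset.map_coe]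
  conv_rhs => rw [← Multiset.sort_eq μ.2.parts (· ≥ ·)]
  congr 1
  apply List.ext_getElem
  · simp
  · intro k h1 h2
    simp only [List.getElem_map, List.getElem_range, partFinsupp_apply, part]
    exact List.getD_eq_getElem _ _ h2

theorem ofFinsupp_mapDomain {e : ℕ → ℕ} (he : Function.Injective e) (m : ℕ →₀ ℕ) :
    ofFinsupp (m.mapDomain e) = ofFinsupp m := by
  classical
  rw [ofFinsupp_eq_iff, Finsupp.mapDomain_support_of_injective he,
    Finset.image_val_of_injOn he.injOn, Multiset.map_map]
  exact Multiset.map_congr rfl fun k _ => by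
    rw [Function.comp_apply, Finsupp.mapDomain_apply he]

/-- This is conjugation of partitions: a weakly decreasing sequence is recovered from the multiset
of its nonzero values. -/
theorem le_apply_iff_lt_card {m : ℕ →₀ ℕ} (hm : Antitone m) {t : ℕ} (ht : 0 < t) (k : ℕ) :
    t ≤ m k ↔ k < Multiset.card ((m.support.val.map m).filter (t ≤ ·)) := by
  classical
  have hfin : (m.support.val.map m).filter (t ≤ ·) =
      (m.support.filter (fun l => t ≤ m l)).val.map m := by
    rw [Multiset.filter_map, Finset.filter_val]
    rfl
  rw [hfin, Multiset.card_map, Finset.card_val]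
  have hmem : ∀ l, l ∈ m.support.filter (fun l => t ≤ m l) ↔ t ≤ m l := fun l => by
    rw [Finset.mem_filter, Finsupp.mem_support_iff]
    exact ⟨fun h => h.2, fun h => ⟨by omega, h⟩⟩
  constructor
  · intro h
    have hsub : Finset.range (k + 1) ⊆ m.support.filter (fun l => t ≤ m l) := fun l hl =>
      (hmem l).2 (h.trans (hm (Nat.lt_succ_iff.1 (Finset.mem_range.1 hl))))
    have := Finset.card_le_card hsub
    rw [Finset.card_range] at this
    omega
  · intro h
    by_contra hlt
    have hsub : m.support.filter (fun l => t ≤ m l) ⊆ Finset.range k := fun l hl => by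
      rw [hmem] at hl
      rw [Finset.mem_range]
      by_contra hkl
      exact hlt (hl.trans (hm (not_lt.1 hkl)))
    have := Finset.card_le_card hsub
    rw [Finset.card_range] at this
    omega

theorem eq_of_antitone_of_ofFinsupp_eq {m m' : ℕ →₀ ℕ} (hm : Antitone m) (hm' : Antitone m')
    (h : ofFinsupp m = ofFinsupp m') : m = m' := by
  rw [ofFinsupp_eq_iff] at h
  ext k
  have key : ∀ t, 0 < t → (t ≤ m k ↔ t ≤ m' k) := fun t ht => by
    rw [le_apply_iff_lt_card hm ht, le_apply_iff_lt_card hm' ht, h]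
  apply le_antisymm
  · rcases Nat.eq_zero_or_pos (m k) with h0 | h0
    · omega
    · exact (key _ h0).1 le_rfl
  · rcases Nat.eq_zero_or_pos (m' k) with h0 | h0
    · omega
    · exact (key _ h0).2 le_rfl

theorem partFinsupp_ofFinsupp {m : ℕ →₀ ℕ} (hm : Antitone m) : partFinsupp (ofFinsupp m) = m :=
  eq_of_antitone_of_ofFinsupp_eq (part_antitone _) hm (ofFinsupp_partFinsupp _)

theorem degree_eq_size_ofFinsupp (m : ℕ →₀ ℕ) : m.degree = (ofFinsupp m).1 := rfl

theorem degree_partFinsupp (μ : Par) : (partFinsupp μ).degree = μ.1 := by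
  rw [degree_eq_size_ofFinsupp, ofFinsupp_partFinsupp]

theorem card_parts_le (μ : Par) : Multiset.card μ.2.parts ≤ μ.1 := by
  have := Multiset.card_nsmul_le_sum (s := μ.2.parts) (a := 1) fun x hx => μ.2.parts_pos hx
  rwa [μ.2.parts_sum, smul_eq_mul, mul_one] at this

end Partitions

/-! ### Sorting the rows of an exponent -/

section Rows

variable {ι : Type*}

/-- The measure that makes sorting of rows by adjacent interchanges terminate. -/
theorem sum_mul_mapDomain_swap_lt [DecidableEq ι] {m : ι × ℕ →₀ ℕ} {i : ι} {j : ℕ}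
    (h : m (i, j) < m (i, j + 1)) :
    ((m.mapDomain (Equiv.swap (i, j) (i, j + 1))).sum fun p a => p.2 * a) <
      m.sum fun p a => p.2 * a := by
  have hne : (i, j) ≠ (i, j + 1) := by simp
  obtain ⟨ρ, hx, hy, hm⟩ := exists_eq_add_single_add_single hne m
  have hρ : ρ.mapDomain (Equiv.swap (i, j) (i, j + 1)) = ρ := by
    ext z
    rw [Finsupp.mapDomain_equiv_apply, Equiv.symm_swap, Equiv.swap_apply_def]
    split_ifs with h1 h2
    · rw [h1, hx, hy]
    · rw [h2, hx, hy]
    · rfl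
  generalize m (i, j) = a at h hm
  generalize m (i, j + 1) = b at h hm
  subst hm
  rw [Finsupp.mapDomain_add, Finsupp.mapDomain_add, hρ, Finsupp.mapDomain_single,
    Finsupp.mapDomain_single, Equiv.swap_apply_left, Equiv.swap_apply_right]
  have hadd : ∀ u v : ι × ℕ →₀ ℕ, ((u + v).sum fun p a => p.2 * a) =
      (u.sum fun p a => p.2 * a) + v.sum fun p a => p.2 * a := fun u v =>
    Finsupp.sum_add_index' (fun _ => mul_zero _) fun _ _ _ => mul_add _ _ _
  rw [hadd, hadd, hadd, hadd]
  simp only [Finsupp.sum_single_index, mul_zero]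
  nlinarith

/-- A property of exponents that can be checked after exchanging two adjacent entries of a row in
the wrong order holds if it holds for exponents with weakly decreasing rows. -/
theorem sort_rows_induction [DecidableEq ι] {P : (ι × ℕ →₀ ℕ) → Prop}
    (hsorted : ∀ m, (∀ i, Antitone fun j => m (i, j)) → P m)
    (hswap : ∀ m i j, m (i, j) < m (i, j + 1) →
      P (m.mapDomain (Equiv.swap (i, j) (i, j + 1))) → P m) (m : ι × ℕ →₀ ℕ) : P m := by
  obtain ⟨N, hN⟩ : ∃ N, N = m.sum fun p a => p.2 * a := ⟨_, rfl⟩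
  induction N using Nat.strong_induction_on generalizing m with
  | _ N ih =>
    subst hN
    by_cases h : ∃ i j, m (i, j) < m (i, j + 1)
    · obtain ⟨i, j, hlt⟩ := h
      exact hswap m i j hlt (ih _ (sum_mul_mapDomain_swap_lt hlt) _ rfl)
    · push Not at h
      exact hsorted m fun i => antitone_nat_of_succ_le (h i)

/-- The partitions formed by the rows of an exponent. -/
def rowPar (m : ι × ℕ →₀ ℕ) (i : ι) : Par := ofFinsupp (m.curry i)

theorem rowPar_mapDomain_swap [DecidableEq ι] (m : ι × ℕ →₀ ℕ) (i : ι) (j k : ℕ) :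
    rowPar (m.mapDomain (Equiv.swap (i, j) (i, k))) = rowPar m := by
  funext i'
  by_cases hi : i' = i
  · subst hi
    have : (m.mapDomain (Equiv.swap (i', j) (i', k))).curry i' =
        (m.curry i').mapDomain (Equiv.swap j k) := by
      ext l
      rw [Finsupp.curry_apply, Finsupp.mapDomain_equiv_apply, Finsupp.mapDomain_equiv_apply,
        Finsupp.curry_apply, Equiv.symm_swap, Equiv.symm_swap,
        (Prod.mk_right_injective i').swap_apply]
    rw [rowPar, this, ofFinsupp_mapDomain (Equiv.injective _), rowPar]
  · have : (m.mapDomain (Equiv.swap (i, j) (i, k))).curry i' = m.curry i' := by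
      ext l
      rw [Finsupp.curry_apply, Finsupp.mapDomain_equiv_apply, Equiv.symm_swap,
        Finsupp.curry_apply, Equiv.swap_apply_of_ne_of_ne] <;> simp [hi]
    rw [rowPar, this, rowPar]

variable [Finite ι]

/-- The exponent whose rows are the given partitions. -/
def rowsFinsupp (μ : ι → Par) : ι × ℕ →₀ ℕ :=
  (Finsupp.equivFunOnFinite.symm fun i => partFinsupp (μ i)).uncurry

@[simp]
theorem rowsFinsupp_apply (μ : ι → Par) (i : ι) (j : ℕ) :
    rowsFinsupp μ (i, j) = part (μ i) j := by
  simp [rowsFinsupp, Finsupp.uncurry_apply]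

theorem rowPar_rowsFinsupp (μ : ι → Par) : rowPar (rowsFinsupp μ) = μ := by
  funext i
  have : (rowsFinsupp μ).curry i = partFinsupp (μ i) := by
    ext j
    simp [Finsupp.curry_apply]
  rw [rowPar, this, ofFinsupp_partFinsupp]

theorem rowsFinsupp_rowPar {m : ι × ℕ →₀ ℕ} (hm : ∀ i, Antitone fun j => m (i, j)) :
    rowsFinsupp (rowPar m) = m := by
  ext ⟨i, j⟩
  rw [rowsFinsupp_apply, rowPar, ← partFinsupp_apply, partFinsupp_ofFinsupp, Finsupp.curry_apply]
  intro j k hjk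
  simpa only [Finsupp.curry_apply] using hm i hjk

end Rows

/-! ### Monomial symmetric functions -/

section Monomial

variable {R : Type*} [CommRing R]

theorem coeff_rename_equiv {σ τ : Type*} (e : σ ≃ τ) (f : MvPowerSeries σ R) (m : σ →₀ ℕ) :
    MvPowerSeries.coeff (m.mapDomain e) (MvPowerSeries.rename e f) =
      MvPowerSeries.coeff m f := by
  have := MvPowerSeries.coeff_embDomain_rename e.toEmbedding f m
  rwa [Finsupp.embDomain_eq_mapDomain] at this

theorem coeff_symFun (f : SymFun R) (m : ℕ →₀ ℕ) :
    MvPowerSeries.coeff m (f : MvPowerSeries ℕ R) =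
      MvPowerSeries.coeff (partFinsupp (ofFinsupp m)) (f : MvPowerSeries ℕ R) := by
  -- A single exponent is treated as an array with one row, so that the sorting induction applies.
  suffices H : ∀ q : Unit × ℕ →₀ ℕ, MvPowerSeries.coeff (q.curry ()) (f : MvPowerSeries ℕ R) =
      MvPowerSeries.coeff (partFinsupp (rowPar q ())) (f : MvPowerSeries ℕ R) by
    have hm : (m.mapDomain (Prod.mk ())).curry () = m := by
      ext j
      rw [Finsupp.curry_apply, Finsupp.mapDomain_apply (Prod.mk_right_injective ())]
    have := H (m.mapDomain (Prod.mk ()))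
    rwa [rowPar, hm] at this
  refine sort_rows_induction (fun q hq => ?_) fun q i j _ ih => ?_
  · rw [rowPar, partFinsupp_ofFinsupp]
    intro j k hjk
    simpa only [Finsupp.curry_apply] using hq () hjk
  · rw [rowPar_mapDomain_swap] at ih
    rw [← ih, ← coeff_rename_equiv (Equiv.swap j (j + 1)), f.2.1]
    congr 2
    ext l
    rw [Finsupp.curry_apply, Finsupp.mapDomain_equiv_apply, Finsupp.mapDomain_equiv_apply,
      Finsupp.curry_apply, Equiv.symm_swap, Equiv.symm_swap,
      ← (Prod.mk_right_injective ()).swap_apply]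

theorem finite_setOf_size_le (d : ℕ) : {μ : Par | μ.1 ≤ d}.Finite := by
  have : {μ : Par | μ.1 ≤ d} ⊆
      ⋃ e ∈ Finset.range (d + 1), Set.range (Sigma.mk (β := Nat.Partition) e) := by
    rintro ⟨e, p⟩ h
    simp only [Set.mem_iUnion]
    exact ⟨e, Finset.mem_range.2 (Nat.lt_succ_iff.2 h), p, rfl⟩
  exact ((Finset.range (d + 1)).finite_toSet.biUnion fun e _ => Set.finite_range _).subset this

/-- The symmetric function with prescribed coefficients at the partitions. -/
def symFunOfCoeff (c : Par →₀ R) : SymFun R :=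
  ⟨fun m => c (ofFinsupp m), by
    refine ⟨fun w => ?_, c.support.sup fun μ => μ.1, fun m hm => ?_⟩
    · ext m
      obtain ⟨m, rfl⟩ : ∃ m', m = Finsupp.mapDomain w m' :=
        ⟨m.mapDomain w.symm, by simp [← Finsupp.mapDomain_comp]⟩
      exact (coeff_rename_equiv w _ m).trans
        (congrArg c (ofFinsupp_mapDomain w.injective m).symm)
    · rw [degree_eq_size_ofFinsupp]
      exact Finset.le_sup (f := fun μ : Par => μ.1) (Finsupp.mem_support_iff.2 hm)⟩

@[simp]
theorem coeff_symFunOfCoeff (c : Par →₀ R) (m : ℕ →₀ ℕ) :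
    MvPowerSeries.coeff m (symFunOfCoeff c : MvPowerSeries ℕ R) = c (ofFinsupp m) := rfl

/-- The basis of the ring of symmetric functions formed by the monomial symmetric functions. -/
def monomialBasis (R : Type*) [CommRing R] : Module.Basis Par R (SymFun R) :=
  .ofRepr <| LinearEquiv.symm
    { toFun := symFunOfCoeff
      map_add' := fun c c' => rfl
      map_smul' := fun a c => rfl
      -- The coordinates are the coefficients at weakly decreasing exponents; bounded degree leaves
      -- finitely many nonzero ones.
      invFun := fun f => Finsupp.onFinset
        (finite_setOf_size_le f.2.2.choose).toFinset
        (fun μ => MvPowerSeries.coeff (partFinsupp μ) (f : MvPowerSeries ℕ R)) (fun μ hμ => by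
          rw [Set.Finite.mem_toFinset, Set.mem_ofPred_eq, ← degree_partFinsupp]
          exact f.2.2.choose_spec _ hμ)
      left_inv := fun c => by
        ext μ
        simp [ofFinsupp_partFinsupp]
      right_inv := fun f => by
        apply Subtype.ext
        ext m
        rw [coeff_symFunOfCoeff, coeff_symFun f m]
        rfl }

theorem coeff_monomialBasis [DecidableEq Par] (μ : Par) (m : ℕ →₀ ℕ) :
    MvPowerSeries.coeff m (monomialBasis R μ : MvPowerSeries ℕ R) =
      if ofFinsupp m = μ then 1 else 0 := by
  change (Finsupp.single μ (1 : R)) (ofFinsupp m) = _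
  rw [Finsupp.single_apply]
  simp only [eq_comm]

end Monomial

/-! ### Multi-symmetric functions as power series -/

section MultiMonomial

variable {R : Type*} [CommRing R] {r : ℕ}

theorem toPowerSeries_tprod (f : Fin r → SymFun R) :
    toPowerSeries R r (PiTensorProduct.tprod R f) =
      ∏ i, MvPowerSeries.rename (fun j : ℕ => (i, j)) (f i : MvPowerSeries ℕ R) := by
  simp [toPowerSeries, PiTensorProduct.liftAlgHom]

theorem sum_mapDomain_curry {ι : Type*} [Fintype ι] (m : ι × ℕ →₀ ℕ) :
    ∑ i, (m.curry i).mapDomain (Prod.mk i) = m := by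
  classical
  ext ⟨i, j⟩
  rw [Finsupp.finsetSum_apply, Finset.sum_eq_single i]
  · rw [Finsupp.mapDomain_apply (Prod.mk_right_injective i), Finsupp.curry_apply]
  · intro i' _ hi
    refine Finsupp.mapDomain_of_notMem_range _ _ ?_
    rintro ⟨k, hk⟩
    exact hi (Prod.ext_iff.1 hk).1
  · simp

/-- The factors involve disjoint sets of variables, so splitting `m` into its rows is the only
decomposition that contributes. -/
theorem coeff_prod_rename (f : Fin r → MvPowerSeries ℕ R) (m : Fin r × ℕ →₀ ℕ) :
    MvPowerSeries.coeff m (∏ i, MvPowerSeries.rename (fun j : ℕ => (i, j)) (f i)) =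
      ∏ i, MvPowerSeries.coeff (m.curry i) (f i) := by
  classical
  have hcoeff : ∀ (i : Fin r) (q : ℕ →₀ ℕ), MvPowerSeries.coeff (q.mapDomain (Prod.mk i))
      (MvPowerSeries.rename (fun j : ℕ => (i, j)) (f i)) = MvPowerSeries.coeff q (f i) := by
    intro i q
    have := MvPowerSeries.coeff_embDomain_rename ⟨Prod.mk i, Prod.mk_right_injective i⟩ (f i) q
    rwa [Finsupp.embDomain_eq_mapDomain] at this
  rw [MvPowerSeries.coeff_prod, Finset.sum_eq_single (Finsupp.equivFunOnFinite.symm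
    fun i => (m.curry i).mapDomain (Prod.mk i))]
  · exact Finset.prod_congr rfl fun i _ => hcoeff i _
  · intro l hl hne
    rw [Finset.mem_finsuppAntidiag] at hl
    by_contra hprod
    have hrow : ∀ i, ∃ q : ℕ →₀ ℕ, q.mapDomain (Prod.mk i) = l i := by
      intro i
      by_contra hi
      exact hprod (Finset.prod_eq_zero (Finset.mem_univ i)
        (MvPowerSeries.coeff_rename_eq_zero _ _ (by simpa using hi)))
    choose q hq using hrow
    refine hne (Finsupp.ext fun i => ?_)
    rw [Finsupp.equivFunOnFinite_symm_apply_apply, ← hq i]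
    congr 1
    ext j
    rw [Finsupp.curry_apply, ← hl.1, Finsupp.finsetSum_apply, Finset.sum_eq_single i]
    · rw [← hq i, Finsupp.mapDomain_apply (Prod.mk_right_injective i)]
    · intro i' _ hi
      rw [← hq i']
      refine Finsupp.mapDomain_of_notMem_range _ _ ?_
      rintro ⟨k, hk⟩
      exact hi (Prod.ext_iff.1 hk).1
    · simp
  · intro h
    refine absurd ?_ h
    rw [Finset.mem_finsuppAntidiag]
    exact ⟨by simpa using sum_mapDomain_curry m, Finset.subset_univ _⟩

/-- The basis of the ring of multi-symmetric functions formed by the products of monomial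
symmetric functions. -/
def multiMonomialBasis (R : Type*) [CommRing R] (r : ℕ) :
    Module.Basis (Fin r → Par) R (MultiSymFun R r) :=
  Basis.piTensorProduct fun _ => monomialBasis R

/-- Both sides are linear in `t`, and on a product of monomial symmetric functions both are the
indicator of equality of the row partitions. -/
theorem coeff_toPowerSeries (t : MultiSymFun R r) (m : Fin r × ℕ →₀ ℕ) :
    MvPowerSeries.coeff m (toPowerSeries R r t) = (multiMonomialBasis R r).repr t (rowPar m) := by
  classical
  suffices H : (MvPowerSeries.coeff m).comp (toPowerSeries R r).toLinearMap =
      (Finsupp.lapply (rowPar m)).comp (multiMonomialBasis R r).repr.toLinearMap from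
    DFunLike.congr_fun H t
  refine (multiMonomialBasis R r).ext fun μ => ?_
  simp only [LinearMap.comp_apply, LinearEquiv.coe_coe, AlgHom.toLinearMap_apply,
    Module.Basis.repr_self, Finsupp.lapply_apply]
  rw [multiMonomialBasis, Basis.piTensorProduct_apply, toPowerSeries_tprod,
    coeff_prod_rename]
  simp only [coeff_monomialBasis]
  rw [Finset.prod_boole, Finsupp.single_apply]
  congr 1
  simp only [Finset.mem_univ, true_implies, eq_iff_iff]
  exact ⟨fun h => funext fun i => (h i).symm, fun h i => (congrFun h i).symm⟩

theorem toPowerSeries_injective : Function.Injective (toPowerSeries R r) := by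
  intro t t' h
  refine (multiMonomialBasis R r).ext_elem fun μ => ?_
  have := congrArg (MvPowerSeries.coeff (rowsFinsupp μ)) h
  rwa [coeff_toPowerSeries, coeff_toPowerSeries, rowPar_rowsFinsupp] at this

theorem finite_setOf_rows_size_le (r d : ℕ) : {μ : Fin r → Par | ∀ i, (μ i).1 ≤ d}.Finite :=
  (Set.Finite.pi fun _ : Fin r => finite_setOf_size_le d).subset fun _ hμ i _ => hμ i

/-- A power series whose coefficients depend only on the partitions formed by the rows of the
exponent, and are zero for large partitions, is a multi-symmetric function. -/
theorem exists_toPowerSeries_eq {F : MvPowerSeries (Fin r × ℕ) R}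
    (hsymm : ∀ m, MvPowerSeries.coeff m F = MvPowerSeries.coeff (rowsFinsupp (rowPar m)) F)
    (d : ℕ) (hd : ∀ μ, MvPowerSeries.coeff (rowsFinsupp μ) F ≠ 0 → ∀ i, (μ i).1 ≤ d) :
    ∃ t, toPowerSeries R r t = F := by
  refine ⟨(multiMonomialBasis R r).repr.symm (Finsupp.onFinset
    (finite_setOf_rows_size_le r d).toFinset
    (fun μ => MvPowerSeries.coeff (rowsFinsupp μ) F) fun μ hμ => by simpa using hd μ hμ), ?_⟩
  ext m
  rw [coeff_toPowerSeries, LinearEquiv.apply_symm_apply, Finsupp.onFinset_apply, ← hsymm]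

end MultiMonomial

/-! ### Unitriangular families -/

section Triangular

variable {ι R M Γ : Type*} [CommRing R] [Nontrivial R] [AddCommGroup M] [Module R M] [LinearOrder Γ]
  [WellFoundedLT Γ]

/-- A family that is unitriangular with respect to a basis is a basis. -/
theorem exists_basis_of_unitriangular (b : Module.Basis ι R M) (v : ι → M) (ρ : ι → Γ)
    (hdiag : ∀ i, b.repr (v i) i = 1)
    (hlt : ∀ i j, b.repr (v i) j ≠ 0 → j ≠ i → ρ j < ρ i) :
    ∃ b' : Module.Basis ι R M, ∀ i, b' i = v i := by
  classical
  -- In a vanishing combination, an index of maximal `ρ` in the support receives no contribution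
  -- from the others, so its coefficient vanishes.
  have hli : LinearIndependent R v := by
    rw [linearIndependent_iff]
    intro l hl
    by_contra hne
    obtain ⟨i, hi, hmax⟩ := l.support.exists_max_image ρ (Finsupp.support_nonempty_iff.2 hne)
    have h := congrArg (fun x => b.repr x i) hl
    simp only [map_zero, Finsupp.coe_zero, Pi.zero_apply] at h
    rw [Finsupp.linearCombination_apply, Finsupp.sum, map_sum, Finsupp.finsetSum_apply,
      Finset.sum_eq_single i] at h
    · rw [map_smul, Finsupp.smul_apply, hdiag, smul_eq_mul, mul_one] at h
      exact Finsupp.mem_support_iff.1 hi h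
    · intro j hj hji
      rw [map_smul, Finsupp.smul_apply]
      by_contra hne
      exact absurd (hlt j i (right_ne_zero_of_smul hne) hji.symm) (not_lt.2 (hmax j hj))
    · exact fun h => absurd hi h
  -- Well-founded induction: `b i` is `v i` minus basis vectors of smaller `ρ`.
  have hmem : ∀ (γ : Γ) (i : ι), ρ i = γ → b i ∈ Submodule.span R (Set.range v) := by
    intro γ
    induction γ using WellFoundedLT.induction with
    | _ γ ih =>
      rintro i rfl
      have hv : v i = b i + ∑ j ∈ (b.repr (v i)).support.erase i, b.repr (v i) j • b j := by
        conv_lhs => rw [← b.linearCombination_repr (v i)]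
        rw [Finsupp.linearCombination_apply, Finsupp.sum,
          ← Finset.add_sum_erase _ _ (a := i)]
        · rw [hdiag, one_smul]
        · rw [Finsupp.mem_support_iff, hdiag]
          exact one_ne_zero
      rw [eq_sub_of_add_eq hv.symm]
      refine Submodule.sub_mem _ (Submodule.subset_span ⟨i, rfl⟩)
        (Submodule.sum_mem _ fun j hj => Submodule.smul_mem _ _ ?_)
      rw [Finset.mem_erase, Finsupp.mem_support_iff] at hj
      exact ih _ (hlt i j hj.2 hj.1) j rfl
  refine ⟨Module.Basis.mk hli ?_, Module.Basis.mk_apply hli _⟩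
  rw [← b.span_eq, Submodule.span_le]
  rintro _ ⟨i, rfl⟩
  exact hmem _ i rfl

end Triangular

/-! ### Windows -/

section Windows

/-- With the offset of a window written over `Finset.range`, offsets of different windows are
compared by inclusion of the ranges. -/
theorem finSigmaFinEquiv_val_eq_sum_range {r : ℕ} {n : Fin r → ℕ} (k : (i : Fin r) × Fin (n i)) :
    (finSigmaFinEquiv k : ℕ) =
      ∑ x ∈ Finset.range k.1, (if h : x < r then n ⟨x, h⟩ else 0) + k.2 := by
  rw [finSigmaFinEquiv_apply, Finset.sum_range]
  congr 1
  refine Finset.sum_congr rfl fun x _ => ?_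
  rw [dif_pos (x.2.trans k.1.2)]
  rfl

theorem finSigmaFinEquiv_lt_of_fst_lt {r : ℕ} {n : Fin r → ℕ} {k l : (i : Fin r) × Fin (n i)}
    (h : k.1 < l.1) : finSigmaFinEquiv k < finSigmaFinEquiv l := by
  rw [Fin.lt_def, finSigmaFinEquiv_val_eq_sum_range, finSigmaFinEquiv_val_eq_sum_range]
  have hsub : Finset.range ((k.1 : ℕ) + 1) ⊆ Finset.range l.1 :=
    Finset.range_subset_range.2 (Fin.lt_def.1 h)
  have hle := Finset.sum_le_sum_of_subset (f := fun x => if h : x < r then n ⟨x, h⟩ else 0) hsub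
  rw [Finset.sum_range_succ, dif_pos k.1.2] at hle
  have := k.2.2
  simp only [Fin.eta] at hle
  omega

theorem finSigmaFinEquiv_lt_iff {r : ℕ} {n : Fin r → ℕ} {i : Fin r} {j j' : Fin (n i)} :
    finSigmaFinEquiv ⟨i, j⟩ < finSigmaFinEquiv (⟨i, j'⟩ : (i : Fin r) × Fin (n i)) ↔ j < j' := by
  rw [Fin.lt_def, finSigmaFinEquiv_val_eq_sum_range, finSigmaFinEquiv_val_eq_sum_range,
    Fin.lt_def]
  exact Nat.add_lt_add_iff_left

theorem windowComp_finSigmaFinEquiv {r : ℕ} (μ : Fin r → Par) (n : Fin r → ℕ) (i : Fin r)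
    (j : Fin (n i)) : windowComp μ n (finSigmaFinEquiv ⟨i, j⟩) = part (μ i) (Fin.rev j) := by
  have h : finSigmaFinEquiv.symm (finSigmaFinEquiv ⟨i, j⟩) = (⟨i, j⟩ : (i : Fin r) × Fin (n i)) :=
    Equiv.symm_apply_apply _ _
  simp only [windowComp]
  rw [h]

/-- The variable at a position of a composition cut into windows. -/
def windowVar {r : ℕ} (n : Fin r → ℕ) (k : Fin (∑ i, n i)) : Fin r × ℕ :=
  ((finSigmaFinEquiv.symm k).1, ((finSigmaFinEquiv.symm k).2 : ℕ))

variable {r : ℕ} {n n' : Fin r → ℕ}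

@[simp]
theorem windowVar_finSigmaFinEquiv (i : Fin r) (j : Fin (n i)) :
    windowVar n (finSigmaFinEquiv ⟨i, j⟩) = (i, (j : ℕ)) := by
  have h : finSigmaFinEquiv.symm (finSigmaFinEquiv ⟨i, j⟩) = (⟨i, j⟩ : (i : Fin r) × Fin (n i)) :=
    Equiv.symm_apply_apply _ _
  rw [windowVar, h]

theorem windowVar_injective (n : Fin r → ℕ) : Function.Injective (windowVar n) := by
  intro k l h
  obtain ⟨⟨i, j⟩, rfl⟩ := finSigmaFinEquiv.surjective k
  obtain ⟨⟨i', j'⟩, rfl⟩ := finSigmaFinEquiv.surjective l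
  rw [windowVar_finSigmaFinEquiv, windowVar_finSigmaFinEquiv, Prod.mk.injEq] at h
  obtain ⟨rfl, h⟩ := h
  rw [Fin.ext h]

theorem mem_range_windowVar {p : Fin r × ℕ} : p ∈ Set.range (windowVar n) ↔ p.2 < n p.1 := by
  constructor
  · rintro ⟨k, rfl⟩
    exact (finSigmaFinEquiv.symm k).2.2
  · intro h
    exact ⟨finSigmaFinEquiv ⟨p.1, ⟨p.2, h⟩⟩, windowVar_finSigmaFinEquiv _ _⟩

/-- The exponent `m` involves only the variables in the windows of the given sizes. -/
def InWindows (n : Fin r → ℕ) (m : Fin r × ℕ →₀ ℕ) : Prop :=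
  ∀ p, m p ≠ 0 → p.2 < n p.1

theorem InWindows.mono (h : n ≤ n') {m : Fin r × ℕ →₀ ℕ} (hm : InWindows n m) :
    InWindows n' m := fun p hp => (hm p hp).trans_le (h p.1)

theorem inWindows_mapDomain_windowVar (q : Fin (∑ i, n i) →₀ ℕ) :
    InWindows n (q.mapDomain (windowVar n)) := by
  intro p hp
  rw [← mem_range_windowVar]
  by_contra h
  exact hp (Finsupp.mapDomain_of_notMem_range _ _ h)

theorem InWindows.exists_eq_mapDomain {m : Fin r × ℕ →₀ ℕ} (hm : InWindows n m) :
    ∃ q : Fin (∑ i, n i) →₀ ℕ, q.mapDomain (windowVar n) = m :=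
  ⟨m.comapDomain (windowVar n) (windowVar_injective n).injOn,
    Finsupp.mapDomain_comapDomain _ (windowVar_injective n) _ fun p hp =>
      mem_range_windowVar.2 (hm p (Finsupp.mem_support_iff.1 hp))⟩

theorem exists_inWindows (m : Fin r × ℕ →₀ ℕ) : ∃ n : Fin r → ℕ, InWindows n m :=
  ⟨fun _ => m.support.sup fun p => p.2 + 1, fun _ hp =>
    Finset.le_sup (f := fun p : Fin r × ℕ => p.2 + 1) (Finsupp.mem_support_iff.2 hp)⟩

theorem rowPar_mapDomain {ι : Type*} {s : ι → ℕ → ℕ} (hs : ∀ i, Function.Injective (s i))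
    (m : ι × ℕ →₀ ℕ) : rowPar (m.mapDomain fun p => (p.1, s p.1 p.2)) = rowPar m := by
  have hinj : Function.Injective fun p : ι × ℕ => (p.1, s p.1 p.2) := by
    rintro ⟨i, j⟩ ⟨i', j'⟩ h
    simp only [Prod.mk.injEq] at h
    obtain ⟨rfl, h⟩ := h
    rw [hs i h]
  funext i
  have : (m.mapDomain fun p => (p.1, s p.1 p.2)).curry i = (m.curry i).mapDomain (s i) := by
    ext l
    rw [Finsupp.curry_apply]
    by_cases hl : l ∈ Set.range (s i)
    · obtain ⟨k, rfl⟩ := hl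
      rw [Finsupp.mapDomain_apply (hs i), Finsupp.curry_apply]
      exact Finsupp.mapDomain_apply hinj m (i, k)
    · rw [Finsupp.mapDomain_of_notMem_range _ _ hl, Finsupp.mapDomain_of_notMem_range]
      rintro ⟨⟨i', k⟩, hk⟩
      simp only [Prod.mk.injEq] at hk
      obtain ⟨rfl, hk⟩ := hk
      exact hl ⟨k, hk⟩
  rw [rowPar, this, ofFinsupp_mapDomain (hs i), rowPar]

end Windows

/-! ### Stability of multi-symmetric Schur polynomials -/

section Stability

variable {r : ℕ} {n n' : Fin r → ℕ} {μ ν : Fin r → Par}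

theorem multiSchurPoly_eq (μ : Fin r → Par) (n : Fin r → ℕ) :
    multiSchurPoly μ n =
      MvPolynomial.rename (windowVar n) (keyPoly ℤ (∑ i, n i) (windowComp μ n)) := rfl

theorem swapVar_multiSchurPoly {i : Fin r} {j : ℕ} (hj : j + 1 < n i) :
    swapVar (i, j) (i, j + 1) (multiSchurPoly μ n) = multiSchurPoly μ n := by
  have hsymm := swapVar_keyPoly (R := ℤ) (α := windowComp μ n)
    (i := finSigmaFinEquiv ⟨i, ⟨j, by omega⟩⟩) (j := finSigmaFinEquiv ⟨i, ⟨j + 1, hj⟩⟩)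
    (by rw [finSigmaFinEquiv_val_eq_sum_range, finSigmaFinEquiv_val_eq_sum_range]; rfl) (by
      rw [windowComp_finSigmaFinEquiv, windowComp_finSigmaFinEquiv]
      refine part_antitone _ ?_
      rw [Fin.val_rev, Fin.val_rev]
      simp only
      omega)
  rw [multiSchurPoly_eq]
  conv_rhs => rw [← hsymm]
  rw [swapVar, swapVar, MvPolynomial.rename_rename, MvPolynomial.rename_rename]
  congr 2
  funext k
  rw [Function.comp_apply, Function.comp_apply, ← (windowVar_injective n).swap_apply,
    windowVar_finSigmaFinEquiv, windowVar_finSigmaFinEquiv]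

theorem coeff_multiSchurPoly_eq_rows {m : Fin r × ℕ →₀ ℕ} (hm : InWindows n m) :
    (multiSchurPoly μ n).coeff m = (multiSchurPoly μ n).coeff (rowsFinsupp (rowPar m)) := by
  revert hm
  refine sort_rows_induction (P := fun m => InWindows n m → (multiSchurPoly μ n).coeff m =
    (multiSchurPoly μ n).coeff (rowsFinsupp (rowPar m))) (fun m hm _ => ?_)
    (fun m i j hlt ih hm => ?_) m
  · rw [rowsFinsupp_rowPar hm]
  -- The larger entry is nonzero, so both positions lie in the window, where the polynomial is
  -- symmetric.
  · have hj : j + 1 < n i := hm (i, j + 1) (by omega)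
    rw [rowPar_mapDomain_swap] at ih
    rw [← ih]
    · conv_rhs => rw [← swapVar_multiSchurPoly hj]
      rw [swapVar, MvPolynomial.coeff_rename_mapDomain _ (Equiv.injective _)]
    · intro p hp
      rw [Finsupp.mapDomain_equiv_apply, Equiv.symm_swap, Equiv.swap_apply_def] at hp
      split_ifs at hp with h1 h2
      · rw [h1]; simp only; omega
      · rw [h2]; exact hj
      · exact hm p hp

/-- The alignment of small windows with the ends of larger ones. -/
def windowShift (h : n ≤ n') (p : (i : Fin r) × Fin (n i)) : (i : Fin r) × Fin (n' i) :=
  ⟨p.1, ⟨n' p.1 - n p.1 + p.2, by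
    have := p.2.2
    have : n p.1 ≤ n' p.1 := h p.1
    omega⟩⟩

/-- The embedding of the positions of small windows as the final positions of larger ones. -/
def windowEmb (h : n ≤ n') (k : Fin (∑ i, n i)) : Fin (∑ i, n' i) :=
  finSigmaFinEquiv (windowShift h (finSigmaFinEquiv.symm k))

theorem windowEmb_finSigmaFinEquiv (h : n ≤ n') (i : Fin r) (j : Fin (n i)) :
    windowEmb h (finSigmaFinEquiv ⟨i, j⟩) = finSigmaFinEquiv ⟨i, ⟨n' i - n i + j, by
      have := j.2
      have : n i ≤ n' i := h i
      omega⟩⟩ := by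
  rw [windowEmb, Equiv.symm_apply_apply]
  rfl

theorem windowEmb_strictMono (h : n ≤ n') : StrictMono (windowEmb h) := by
  intro k l hkl
  obtain ⟨⟨i, j⟩, rfl⟩ := finSigmaFinEquiv.surjective k
  obtain ⟨⟨i', j'⟩, rfl⟩ := finSigmaFinEquiv.surjective l
  rw [windowEmb_finSigmaFinEquiv, windowEmb_finSigmaFinEquiv]
  rcases lt_trichotomy i i' with hi | rfl | hi
  · exact finSigmaFinEquiv_lt_of_fst_lt hi
  · rw [finSigmaFinEquiv_lt_iff] at hkl ⊢
    rw [Fin.lt_def] at hkl ⊢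
    simp only
    omega
  · exact absurd hkl (finSigmaFinEquiv_lt_of_fst_lt hi).not_gt

theorem windowComp_comp_windowEmb (h : n ≤ n') :
    windowComp μ n' ∘ windowEmb h = windowComp μ n := by
  funext k
  obtain ⟨⟨i, j⟩, rfl⟩ := finSigmaFinEquiv.surjective k
  rw [Function.comp_apply, windowEmb_finSigmaFinEquiv, windowComp_finSigmaFinEquiv,
    windowComp_finSigmaFinEquiv, Fin.val_rev, Fin.val_rev]
  congr 1
  have := j.2
  have : n i ≤ n' i := h i
  simp only
  omega

theorem windowComp_eq_zero_of_notMem (h : n ≤ n') (hμ : ∀ i, Multiset.card (μ i).2.parts ≤ n i)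
    {k : Fin (∑ i, n' i)} (hk : k ∉ Set.range (windowEmb h)) : windowComp μ n' k = 0 := by
  obtain ⟨⟨i, j⟩, rfl⟩ := finSigmaFinEquiv.surjective k
  rw [windowComp_finSigmaFinEquiv]
  refine part_eq_zero_of_card_le ((hμ i).trans ?_)
  by_contra hlt
  rw [Fin.val_rev] at hlt
  have hj := j.2
  have hi : n i ≤ n' i := h i
  refine hk ⟨finSigmaFinEquiv ⟨i, ⟨j - (n' i - n i), by omega⟩⟩, ?_⟩
  rw [windowEmb_finSigmaFinEquiv]
  congr 2
  apply Fin.ext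
  simp only
  omega

theorem windowVar_windowEmb (h : n ≤ n') (k : Fin (∑ i, n i)) :
    windowVar n' (windowEmb h k) =
      ((windowVar n k).1, n' (windowVar n k).1 - n (windowVar n k).1 + (windowVar n k).2) := by
  obtain ⟨⟨i, j⟩, rfl⟩ := finSigmaFinEquiv.surjective k
  rw [windowEmb_finSigmaFinEquiv, windowVar_finSigmaFinEquiv, windowVar_finSigmaFinEquiv]

/-- Killing the leading variables of the large windows identifies the two coefficients up to the
shift `j ↦ n' i - n i + j` of the exponent. The shift preserves the row partitions, so symmetry
removes it. -/
theorem coeff_multiSchurPoly_eq_of_le (h : n ≤ n')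
    (hμ : ∀ i, Multiset.card (μ i).2.parts ≤ n i) {m : Fin r × ℕ →₀ ℕ} (hm : InWindows n m) :
    (multiSchurPoly μ n').coeff m = (multiSchurPoly μ n).coeff m := by
  obtain ⟨q, rfl⟩ := hm.exists_eq_mapDomain
  have hkill := congrArg (MvPolynomial.coeff q) (killCompl_keyPoly (R := ℤ)
    (windowEmb_strictMono h) fun k hk => windowComp_eq_zero_of_notMem (μ := μ) h hμ hk)
  rw [MvPolynomial.coeff_killCompl, windowComp_comp_windowEmb] at hkill
  have hshift : (q.mapDomain (windowEmb h)).mapDomain (windowVar n') =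
      (q.mapDomain (windowVar n)).mapDomain fun p => (p.1, n' p.1 - n p.1 + p.2) := by
    rw [← Finsupp.mapDomain_comp, ← Finsupp.mapDomain_comp]
    congr 1
    funext k
    exact windowVar_windowEmb h k
  conv_rhs => rw [multiSchurPoly_eq, MvPolynomial.coeff_rename_mapDomain _ (windowVar_injective n),
    ← hkill, ← MvPolynomial.coeff_rename_mapDomain _ (windowVar_injective n'),
    ← multiSchurPoly_eq, coeff_multiSchurPoly_eq_rows (inWindows_mapDomain_windowVar _), hshift,
    rowPar_mapDomain (s := fun i j => n' i - n i + j) fun i => add_right_injective _]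
  exact coeff_multiSchurPoly_eq_rows (hm.mono h)

theorem exists_tendsto_multiSchurPoly (μ : Fin r → Par) :
    ∃ F : MvPowerSeries (Fin r × ℕ) ℤ,
      Tendsto (fun n : Fin r → ℕ => (multiSchurPoly μ n : MvPowerSeries (Fin r × ℕ) ℤ)) atTop
        (𝓝 F) := by
  have hex : ∀ m : Fin r × ℕ →₀ ℕ, ∃ n : Fin r → ℕ,
      (∀ i, Multiset.card (μ i).2.parts ≤ n i) ∧ InWindows n m := fun m => by
    obtain ⟨n, hn⟩ := exists_inWindows m
    exact ⟨n ⊔ fun i => Multiset.card (μ i).2.parts, fun i => le_sup_right, hn.mono le_sup_left⟩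
  choose n hcard hwin using hex
  -- The limit is read off coefficientwise, with windows large enough for both `μ` and the exponent
  -- `m`.
  refine ⟨fun m => (multiSchurPoly μ (n m)).coeff m,
    (MvPowerSeries.WithPiTopology.tendsto_iff_coeff_tendsto _ _ _).2 fun m => ?_⟩
  refine tendsto_const_nhds.congr' ?_
  filter_upwards [eventually_ge_atTop (n m)] with n' hn'
  rw [MvPolynomial.coeff_coe, coeff_multiSchurPoly_eq_of_le hn' (hcard m) (hwin m)]
  rfl

theorem tendsto_multiSchurPoly (μ : Fin r → Par) :
    Tendsto (fun n : Fin r → ℕ => (multiSchurPoly μ n : MvPowerSeries (Fin r × ℕ) ℤ)) atTop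
      (𝓝 (multiSchur μ)) :=
  tendsto_nhds_limUnder (exists_tendsto_multiSchurPoly μ)

theorem coeff_multiSchur (hμ : ∀ i, Multiset.card (μ i).2.parts ≤ n i) {m : Fin r × ℕ →₀ ℕ}
    (hm : InWindows n m) :
    MvPowerSeries.coeff m (multiSchur μ) = (multiSchurPoly μ n).coeff m := by
  have h := ((MvPowerSeries.WithPiTopology.tendsto_iff_coeff_tendsto _ _ _).1
    (tendsto_multiSchurPoly μ)) m
  refine tendsto_nhds_unique h (tendsto_const_nhds.congr' ?_)
  filter_upwards [eventually_ge_atTop n] with n' hn'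
  rw [MvPolynomial.coeff_coe, coeff_multiSchurPoly_eq_of_le hn' hμ hm]

theorem coeff_multiSchur_eq_rows (μ : Fin r → Par) (m : Fin r × ℕ →₀ ℕ) :
    MvPowerSeries.coeff m (multiSchur μ) =
      MvPowerSeries.coeff (rowsFinsupp (rowPar m)) (multiSchur μ) := by
  obtain ⟨n, hn⟩ := exists_inWindows m
  obtain ⟨n', hn'⟩ := exists_inWindows (rowsFinsupp (rowPar m))
  have hcard : ∀ i, Multiset.card (μ i).2.parts ≤
      (n ⊔ n' ⊔ fun i => Multiset.card (μ i).2.parts) i := fun i => le_sup_right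
  have hwin := hn.mono ((le_sup_left (b := n')).trans
    (le_sup_left (b := fun i => Multiset.card (μ i).2.parts)))
  rw [coeff_multiSchur hcard hwin, coeff_multiSchurPoly_eq_rows hwin,
    coeff_multiSchur hcard (hn'.mono (le_sup_right.trans le_sup_left))]

end Stability

/-! ### Triangularity of multi-symmetric Schur functions -/

section Triangularity

variable {r : ℕ} {n : Fin r → ℕ} {μ ν : Fin r → Par}

/-- The composition of a tuple of partitions as an exponent. -/
def windowFinsupp (ν : Fin r → Par) (n : Fin r → ℕ) : Fin (∑ i, n i) →₀ ℕ :=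
  Finsupp.equivFunOnFinite.symm (windowComp ν n)

@[simp]
theorem coe_windowFinsupp (ν : Fin r → Par) (n : Fin r → ℕ) :
    (windowFinsupp ν n : Fin (∑ i, n i) → ℕ) = windowComp ν n := rfl

theorem rowPar_mapDomain_windowFinsupp (hν : ∀ i, Multiset.card (ν i).2.parts ≤ n i) :
    rowPar ((windowFinsupp ν n).mapDomain (windowVar n)) = ν := by
  -- Windows list the parts in reverse; `s i` reverses the first `n i` indices and fixes the others,
  -- so it is an involution.
  let s (i : Fin r) (j : ℕ) : ℕ := if j < n i then n i - (j + 1) else j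
  have hss : ∀ i j, s i (s i j) = j := fun i j => by
    simp only [s]
    split_ifs <;> omega
  have hinj : ∀ i, Function.Injective (s i) := fun i => Function.LeftInverse.injective (hss i)
  have hinj' : Function.Injective fun p : Fin r × ℕ => (p.1, s p.1 p.2) :=
    Function.LeftInverse.injective (g := fun p : Fin r × ℕ => (p.1, s p.1 p.2)) fun p => by
      simp only [hss]
  have key : (windowFinsupp ν n).mapDomain (windowVar n) =
      (rowsFinsupp ν).mapDomain fun p => (p.1, s p.1 p.2) := by
    ext ⟨i, j⟩
    have hr := Finsupp.mapDomain_apply hinj' (rowsFinsupp ν) (i, s i j)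
    simp only [hss] at hr
    rw [hr, rowsFinsupp_apply]
    by_cases hj : j < n i
    · have hl := Finsupp.mapDomain_apply (windowVar_injective n) (windowFinsupp ν n)
        (finSigmaFinEquiv ⟨i, ⟨j, hj⟩⟩)
      rw [windowVar_finSigmaFinEquiv, coe_windowFinsupp, windowComp_finSigmaFinEquiv,
        Fin.val_rev] at hl
      rw [hl]
      simp only [s, if_pos hj]
    · rw [Finsupp.mapDomain_of_notMem_range _ _ fun h => hj (mem_range_windowVar.1 h),
        part_eq_zero_of_card_le]
      simp only [s, if_neg hj]
      exact (hν i).trans (not_lt.1 hj)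
  rw [key, rowPar_mapDomain hinj, rowPar_rowsFinsupp]

theorem eq_of_windowFinsupp_eq (hμ : ∀ i, Multiset.card (μ i).2.parts ≤ n i)
    (hν : ∀ i, Multiset.card (ν i).2.parts ≤ n i) (h : windowFinsupp μ n = windowFinsupp ν n) :
    μ = ν := by
  rw [← rowPar_mapDomain_windowFinsupp hμ, h, rowPar_mapDomain_windowFinsupp hν]

theorem degree_mapDomain_eq {σ τ : Type*} (f : σ → τ) (m : σ →₀ ℕ) :
    (m.mapDomain f).degree = m.degree := by
  exact Finsupp.sum_mapDomain_index (h := fun _ a => a) (fun _ => rfl) fun _ _ _ => rfl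

theorem degree_eq_sum_rowPar {ι : Type*} [Fintype ι] (m : ι × ℕ →₀ ℕ) :
    m.degree = ∑ i, (rowPar m i).1 := by
  conv_lhs => rw [← sum_mapDomain_curry m]
  rw [map_sum]
  exact Finset.sum_congr rfl fun i _ => by
    rw [degree_mapDomain_eq, degree_eq_size_ofFinsupp, rowPar]

theorem sum_windowComp (hν : ∀ i, Multiset.card (ν i).2.parts ≤ n i) :
    ∑ k, windowComp ν n k = ∑ i, (ν i).1 := by
  have h := degree_eq_sum_rowPar ((windowFinsupp ν n).mapDomain (windowVar n))
  rwa [degree_mapDomain_eq, rowPar_mapDomain_windowFinsupp hν, Finsupp.degree_eq_sum] at h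

/-- By symmetry the decreasing rows of `ν` may be reversed inside the windows, giving the exponent
`windowComp ν n`, to which triangularity of key polynomials applies. -/
theorem coeff_rowsFinsupp_multiSchur (hμ : ∀ i, Multiset.card (μ i).2.parts ≤ n i)
    (hν : ∀ i, Multiset.card (ν i).2.parts ≤ n i) :
    MvPowerSeries.coeff (rowsFinsupp ν) (multiSchur μ) =
      (keyPoly ℤ (∑ i, n i) (windowComp μ n)).coeff (windowFinsupp ν n) := by
  have h := coeff_multiSchur_eq_rows μ ((windowFinsupp ν n).mapDomain (windowVar n))
  rw [rowPar_mapDomain_windowFinsupp hν] at h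
  rw [← h, coeff_multiSchur hμ (inWindows_mapDomain_windowVar _), multiSchurPoly_eq,
    MvPolynomial.coeff_rename_mapDomain _ (windowVar_injective n)]

theorem coeff_rowsFinsupp_multiSchur_self (μ : Fin r → Par) :
    MvPowerSeries.coeff (rowsFinsupp μ) (multiSchur μ) = 1 := by
  have hμ : ∀ i, Multiset.card (μ i).2.parts ≤ (μ i).1 := fun i => card_parts_le _
  rw [coeff_rowsFinsupp_multiSchur hμ hμ]
  have h := keyPoly_sub_monomial_mem (R := ℤ) (windowFinsupp μ fun i => (μ i).1)
  rw [MvPolynomial.mem_restrictSupport_iff] at h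
  by_contra hne
  refine (h (a := windowFinsupp μ fun i => (μ i).1) ?_).2 rfl
  rw [Finset.mem_coe, MvPolynomial.mem_support_iff, MvPolynomial.coeff_sub,
    MvPolynomial.coeff_monomial, if_pos rfl]
  exact sub_ne_zero.2 hne

theorem below_of_coeff_ne_zero (hμ : ∀ i, Multiset.card (μ i).2.parts ≤ n i)
    (hν : ∀ i, Multiset.card (ν i).2.parts ≤ n i) (hne : ν ≠ μ)
    (h : MvPowerSeries.coeff (rowsFinsupp ν) (multiSchur μ) ≠ 0) :
    Below (windowComp ν n) (windowComp μ n) ∧ windowComp ν n ≠ windowComp μ n := by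
  rw [coeff_rowsFinsupp_multiSchur hμ hν] at h
  have hmem := keyPoly_sub_monomial_mem (R := ℤ) (windowFinsupp μ n)
  rw [MvPolynomial.mem_restrictSupport_iff] at hmem
  have hne' : windowFinsupp ν n ≠ windowFinsupp μ n := fun h' =>
    hne (eq_of_windowFinsupp_eq hν hμ h')
  have := hmem (a := windowFinsupp ν n) (by
    rw [Finset.mem_coe, MvPolynomial.mem_support_iff, MvPolynomial.coeff_sub,
      MvPolynomial.coeff_monomial, if_neg hne'.symm, sub_zero]
    exact h)
  exact ⟨this.1, fun h' => this.2 (DFunLike.coe_injective h')⟩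

theorem sum_size_eq_of_coeff_ne_zero
    (h : MvPowerSeries.coeff (rowsFinsupp ν) (multiSchur μ) ≠ 0) :
    ∑ i, (ν i).1 = ∑ i, (μ i).1 := by
  by_cases hne : ν = μ
  · rw [hne]
  have hμ : ∀ i, Multiset.card (μ i).2.parts ≤ (μ i).1 + (ν i).1 := fun i =>
    (card_parts_le _).trans (Nat.le_add_right _ _)
  have hν : ∀ i, Multiset.card (ν i).2.parts ≤ (μ i).1 + (ν i).1 := fun i =>
    (card_parts_le _).trans (Nat.le_add_left _ _)
  rw [← sum_windowComp hμ, ← sum_windowComp hν]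
  exact (below_of_coeff_ne_zero hμ hν hne h).1.sum_eq

theorem size_le_sum (μ : Fin r → Par) (i : Fin r) : (μ i).1 ≤ ∑ i, (μ i).1 :=
  Finset.single_le_sum (f := fun i => (μ i).1) (fun _ _ => Nat.zero_le _) (Finset.mem_univ i)

theorem rank_lt_of_coeff_ne_zero (hne : ν ≠ μ)
    (h : MvPowerSeries.coeff (rowsFinsupp ν) (multiSchur μ) ≠ 0) :
    rank (windowComp ν fun _ => ∑ i, (ν i).1) < rank (windowComp μ fun _ => ∑ i, (μ i).1) := by
  have hsize := sum_size_eq_of_coeff_ne_zero h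
  have hμ : ∀ i, Multiset.card (μ i).2.parts ≤ ∑ i, (μ i).1 := fun i =>
    (card_parts_le _).trans (size_le_sum μ i)
  have hν : ∀ i, Multiset.card (ν i).2.parts ≤ ∑ i, (μ i).1 := fun i =>
    (card_parts_le _).trans ((size_le_sum ν i).trans hsize.le)
  -- A nonzero coefficient forces equal total sizes, so both ranks use the same windows, long enough
  -- for `μ` and `ν`.
  rw [hsize]
  obtain ⟨h1, h2⟩ := below_of_coeff_ne_zero hμ hν hne h
  exact h1.rank_lt h2

theorem exists_toPowerSeries_eq_multiSchur (μ : Fin r → Par) :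
    ∃ t, toPowerSeries ℤ r t = multiSchur μ :=
  exists_toPowerSeries_eq (coeff_multiSchur_eq_rows μ) (∑ i, (μ i).1) fun ν h i =>
    (size_le_sum ν i).trans (sum_size_eq_of_coeff_ne_zero h).le

theorem exists_basis_multiSchur (r : ℕ) :
    ∃ b : Module.Basis (Fin r → Par) ℤ (MultiSymFun ℤ r),
      ∀ μ, toPowerSeries ℤ r (b μ) = multiSchur μ := by
  choose v hv using exists_toPowerSeries_eq_multiSchur (r := r)
  have hrepr : ∀ μ ν, (multiMonomialBasis ℤ r).repr (v μ) ν =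
      MvPowerSeries.coeff (rowsFinsupp ν) (multiSchur μ) := fun μ ν => by
    rw [← hv, coeff_toPowerSeries, rowPar_rowsFinsupp]
  obtain ⟨b, hb⟩ := exists_basis_of_unitriangular (multiMonomialBasis ℤ r) v
    (fun μ => rank (windowComp μ fun _ => ∑ i, (μ i).1))
    (fun μ => by rw [hrepr, coeff_rowsFinsupp_multiSchur_self])
    (fun μ ν h hne => rank_lt_of_coeff_ne_zero hne (by rwa [hrepr] at h))
  exact ⟨b, fun μ => by rw [hb, hv]⟩

end Triangularity

end

end MultiSchur

theorem mainTheorem8 (r : ℕ) :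
    (∀ μ : Fin r → MultiSchur.Par,
      Tendsto (fun n : Fin r → ℕ =>
          (MultiSchur.multiSchurPoly μ n : MvPowerSeries (Fin r × ℕ) ℤ))
        atTop (𝓝 (MultiSchur.multiSchur μ))) ∧
    Function.Injective (MultiSchur.toPowerSeries ℤ r) ∧
    ∃ b : Module.Basis (Fin r → MultiSchur.Par) ℤ (MultiSchur.MultiSymFun ℤ r),
      ∀ μ : Fin r → MultiSchur.Par,
        MultiSchur.toPowerSeries ℤ r (b μ) = MultiSchur.multiSchur μ :=
  ⟨MultiSchur.tendsto_multiSchurPoly, MultiSchur.toPowerSeries_injective,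
    MultiSchur.exists_basis_multiSchur r⟩
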